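/- **Setting.** A seller must sell an asset before a deadline that is $t\ge 0$ time units away. Offers arrive as a Poisson process of rate $\lambda>0$: the durations $D_1,D_2,\dots$ between consecutive offers are exponentially distributed with rate $\lambda$, and the $i$-th offer $X_i$ arrives when the time left to the deadline is $t_i=\max(t_{i-1}-D_i,0)$, $t_0=t$. The offers $X_i$ have the cumulative distribution function $F$, with $E[\max(X_i,0)]<\infty$. When the $i$-th offer arrives with $t_i>0$, the seller either accepts it, so that the process ends with sale price $X_i$ at time $t-t_i$, or rejects it irrevocably, using only the information available so far. If no offer is accepted before the deadline, the process ends at time $t$ with a residual price $X_0$, where $E|X_0|<\infty$. All the variables $D_i$, $X_i$, $X_0$ are mutually independent. Let $\mu_0=E[X_0]$ and $M=\sup\{x: F(x)<1\}\le+\infty$, and assume $0\le\mu_0<M$. For $s\ge0$ let $\mu(s)$ be the maximal (supremal) expected sale price over all such acceptance rules when the time to the deadline is $s$ and no offer is at hand. The optimal policy accepts the first offer $x$, arriving with time $s>0$ left to the deadline, that satisfies $x\ge\mu(s)$. Let the *time to sale* $T_t$ be the (random) time elapsed from the start until the process ends, when the optimal policy is followed from time $t$ to the deadline. Put $$\phi(x)=\int_x^\infty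 [1-F(u)]\,du .$$ **Theorem.** $T_t$ is a random variable with cumulative distribution function $$H_t(r)=P(T_t\le r)=\begin{cases}0 & r<0,\\[2pt] 1-\dfrac{\phi(\mu(t))}{\phi(\mu(t-r))} & 0\le r<t,\\[6pt] 1 & r\ge t,\ r\ge 0.\end{cases}$$ In particular, the probability that no sale is made before the deadline is $$P(T_t=t)=H_t(t+)-H_t(t-)=\frac{\phi(\mu(t))}{\phi(\mu_0)},$$ where $H_t(t\pm)$ denote the one-sided limits of $H_t$ at $t$. -/

import Mathlib

open MeasureTheory ProbabilityTheory Filter Topology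

/-- The bidding process: the `n`-th offer (`n = 0, 1, 2, …`) has size `X n` and arrives a duration
`D n` after the previous one (after the start, for `n = 0`). The durations are exponential of rate
`rate`, the offers have law `ν`, the residual price `X₀`, obtained when the deadline passes without
a sale, has law `ν₀`, and all these random variables are mutually independent. -/
structure BiddingProcess {Ω : Type*} [MeasurableSpace Ω] (P : Measure Ω) (rate : ℝ)
    (ν ν₀ : Measure ℝ) where
  D : ℕ → Ω → ℝ
  X : ℕ → Ω → ℝ
  X₀ : Ω → ℝ
  measurable_D : ∀ n, Measurable (D n)
  measurable_X : ∀ n, Measurable (X n)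
  measurable_X₀ : Measurable X₀
  law_D : ∀ n, P.map (D n) = expMeasure rate
  law_X : ∀ n, P.map (X n) = ν
  law_X₀ : P.map X₀ = ν₀
  indep : iIndepFun (Sum.elim D (Sum.elim X fun _ : Unit => X₀)) P

namespace BiddingProcess

variable {Ω : Type*} [MeasurableSpace Ω] {P : Measure Ω} {rate : ℝ} {ν ν₀ : Measure ℝ}

/-- The information available when the `n`-th offer arrives: the durations and the offers up to and
including the `n`-th. -/
noncomputable def history (B : BiddingProcess P rate ν ν₀) :
    Filtration ℕ (inferInstance : MeasurableSpace Ω) :=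
  Filtration.natural (fun n ω => (B.D n ω, B.X n ω))
    (fun n => ((B.measurable_D n).prodMk (B.measurable_X n)).stronglyMeasurable)

/-- `timeLeft t 0 = t`, and `timeLeft t (n + 1)` is the time remaining to the deadline when the
`n`-th offer arrives (`0` if the deadline has passed), for the process started when the time to the
deadline is `t`. -/
noncomputable def timeLeft (B : BiddingProcess P rate ν ν₀) (t : ℝ) : ℕ → Ω → ℝ
  | 0, _ => t
  | n + 1, ω => max (B.timeLeft t n ω - B.D n ω) 0

/-- The rule `τ` (giving the index of the offer to accept, `⊤` meaning none) leads to the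
acceptance of the `n`-th offer, which arrives before the deadline. -/
def SoldAt (B : BiddingProcess P rate ν ν₀) (t : ℝ) (τ : Ω → WithTop ℕ) (n : ℕ) (ω : Ω) : Prop :=
  τ ω = (n : WithTop ℕ) ∧ 0 < B.timeLeft t (n + 1) ω

open Classical in
/-- The realized sale price under the rule `τ`: the accepted offer, or the residual price if no
offer is accepted before the deadline. -/
noncomputable def salePrice (B : BiddingProcess P rate ν ν₀) (t : ℝ) (τ : Ω → WithTop ℕ) (ω : Ω) :
    ℝ :=
  if h : ∃ n, B.SoldAt t τ n ω then B.X h.choose ω else B.X₀ ω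

open Classical in
/-- The time to sale under the rule `τ`: the time elapsed until the accepted offer arrives, or `t`
if no offer is accepted before the deadline. -/
noncomputable def saleTime (B : BiddingProcess P rate ν ν₀) (t : ℝ) (τ : Ω → WithTop ℕ) (ω : Ω) :
    ℝ :=
  if h : ∃ n, B.SoldAt t τ n ω then t - B.timeLeft t (h.choose + 1) ω else t

/-- The index chosen by `SoldAt` is unique. -/
theorem SoldAt.unique {B : BiddingProcess P rate ν ν₀} {t : ℝ} {τ : Ω → WithTop ℕ} {m n : ℕ} {ω : Ω}
    (hm : B.SoldAt t τ m ω) (hn : B.SoldAt t τ n ω) : m = n :=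
  WithTop.coe_injective (hm.1.symm.trans hn.1)

/-- `μ(t)`: the maximal expected sale price that can be achieved, over all non-anticipating rules,
when the time to the deadline is `t` and no offer is at hand (none has arrived yet, or the current
one has been rejected). Only the positive part of an offer is assumed integrable, so a rule
whose sale price is not integrable has expected sale price `-∞` and does not count. -/
noncomputable def optimalValue (B : BiddingProcess P rate ν ν₀) (t : ℝ) : ℝ :=
  sSup {v : ℝ | ∃ τ : Ω → WithTop ℕ, IsStoppingTime B.history τ ∧
    Integrable (B.salePrice t τ) P ∧ v = ∫ ω, B.salePrice t τ ω ∂P}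

open Classical in
/-- The optimal policy when the process is started at time `t` to the deadline: accept the first
offer `x` that is at least `μ(s)`, where `s` is the time left to the deadline when it arrives. -/
noncomputable def optimalRule (B : BiddingProcess P rate ν ν₀) (t : ℝ) (ω : Ω) : WithTop ℕ :=
  if h : ∃ n, B.optimalValue (B.timeLeft t (n + 1) ω) ≤ B.X n ω then
    ((Nat.find h : ℕ) : WithTop ℕ) else ⊤

/-- The time to sale `T_t` when the optimal policy is followed. -/
noncomputable def timeToSale (B : BiddingProcess P rate ν ν₀) (t : ℝ) : Ω → ℝ :=
  B.saleTime t (B.optimalRule t)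

end BiddingProcess

/-- The function `φ(x) = ∫_x^∞ (1 - F(u)) du`, where `F` is the CDF of the offer law `ν`. -/
noncomputable def offerPhi (ν : Measure ℝ) (x : ℝ) : ℝ :=
  ∫ u in Set.Ioi x, (1 - cdf ν u)

/-- `M = sup {x | F(x) < 1}`, possibly `+∞`, where `F` is the CDF of the offer law `ν`. -/
noncomputable def offerSup (ν : Measure ℝ) : EReal :=
  sSup ((fun x : ℝ => (x : EReal)) '' {x : ℝ | cdf ν x < 1})

/-!
The proof identifies the optimal value with the solution `m` of the differential equation
`m' = rate * φ(m)`, `m 0 = μ₀`, and then computes the law of the time to sale from a martingale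
built on `φ(m)`.

*The equation.* By the layer cake formula `φ(v) = E[(X - v)⁺]` (`offerPhi_eq_integral`), so `φ` is
`1`-Lipschitz, antitone, positive below `M`, and has derivative `-(1 - F)` off the atoms of the
offer law. The vector field is Lipschitz, and bounded on `[μ₀, ∞)`, so a global solution exists
(`exists_isValueCurve`). It never reaches a zero of `φ`, because such a zero is an equilibrium.

*One step.* Let `s` be the time left, `d` an exponential duration and `x` an independent offer.
`integral_expMeasure_of_hasDerivAt` turns a differential equation `k' = rate * (b - k)` into the
statement that `k s` is the expectation of `b (s - d)`, paid if `s - d` is above a level `c`, and of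
`k c` otherwise. With `k = m` this says that `m s` is the expected maximum of the next offer and of
`m (s - d)` (`IsValueCurve.integral_nextValue`). With `k = φ(m)` it says that `φ(m)`, killed when an
offer is at least `m (s - d)`, has constant expectation (`IsValueCurve.integral_nextSurvival`).
The atoms of the offer law only spoil the derivative of `φ(m)` at countably many times, since `m`
is strictly increasing on `[0, ∞)`. The independence of an offer from its past extends these
identities to the bidding process (`BiddingProcess.setIntegral_next_eq`).

*Verification.* Under any rule, the sale price if sold, and `m` at the time left otherwise, is a
supermartingale along the offers. It starts at `m t` and, as almost surely no time is left after
finitely many offers, it ends at the sale price, up to replacing the residual price by its mean.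
For the rule with threshold `m` it is a nonnegative martingale. Hence the optimal value is `m`
(`BiddingProcess.optimalValue_eq`), and the optimal rule is the rule with threshold `m`.

*The law.* Stop `φ(m)` when the time left falls below `c` and kill it at the sale. The
expectation starts at `φ(m t)` and ends at `φ(m c)` times the probability of no sale before the
level `c` is passed (`BiddingProcess.measureReal_forall_not_acceptsBy`). For `c = t - r` this
probability is `1 - H_t(r)`, and for `c = 0` it is the probability of no sale at all.
-/

/-! ### Global solutions of a scalar differential equation -/

/-- A bounded Lipschitz vector field on the line has an integral curve defined for all times: the
Picard–Lindelöf theorem gives one on every symmetric interval, and these agree by uniqueness. -/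
theorem exists_hasDerivAt_of_lipschitzWith_of_bounded {f : ℝ → ℝ} {K L : NNReal}
    (hK : LipschitzWith K f) (hL : ∀ x, ‖f x‖ ≤ L) (x₀ : ℝ) :
    ∃ m : ℝ → ℝ, m 0 = x₀ ∧ ∀ t, HasDerivAt m (f (m t)) t := by
  have hloc : ∀ N : ℕ, ∃ α : ℝ → ℝ, α 0 = x₀ ∧
      ∀ t ∈ Set.Ioo (-(N : ℝ)) N, HasDerivAt α (f (α t)) t := by
    intro N
    have h0 : (0 : ℝ) ∈ Set.Icc (-(N : ℝ)) N := by simp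
    have hP : IsPicardLindelof (fun _ => f) (⟨0, h0⟩ : Set.Icc (-(N : ℝ)) N) x₀ (L * N) 0 L K :=
      IsPicardLindelof.of_time_independent (fun x _ => hL x) hK.lipschitzOnWith (by simp)
    obtain ⟨α, hα0, hα⟩ := hP.exists_eq_forall_mem_Icc_hasDerivWithinAt₀
    exact ⟨α, hα0, fun t ht =>
      (hα t (Set.Ioo_subset_Icc_self ht)).hasDerivAt (Icc_mem_nhds ht.1 ht.2)⟩
  choose α hα0 hα using hloc
  have hagree : ∀ (N M : ℕ) (t : ℝ), |t| < N → |t| < M → α N t = α M t := by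
    have key : ∀ (N M : ℕ) (t : ℝ), N ≤ M → |t| < N → α N t = α M t := by
      intro N M t hNM ht
      have hNM' : (N : ℝ) ≤ M := by exact_mod_cast hNM
      have hN : (0 : ℝ) < N := (abs_nonneg t).trans_lt ht
      exact ODE_solution_unique_of_mem_Ioo (v := fun _ => f) (s := fun _ => Set.univ) (K := K)
        (a := -(N : ℝ)) (b := N) (t₀ := 0) (fun _ _ => hK.lipschitzOnWith)
        ⟨by linarith, hN⟩ (fun t ht => ⟨hα N t ht, trivial⟩)
        (fun t ht => ⟨hα M t ⟨by linarith [ht.1], by linarith [ht.2]⟩, trivial⟩)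
        ((hα0 N).trans (hα0 M).symm) (abs_lt.1 ht)
    intro N M t h1 h2
    rcases le_total N M with h | h
    · exact key N M t h h1
    · exact (key M N t h h2).symm
  have hidx : ∀ t : ℝ, |t| < ((⌈|t|⌉₊ + 1 : ℕ) : ℝ) := fun t => by
    push_cast
    linarith [Nat.le_ceil |t|]
  refine ⟨fun t => α (⌈|t|⌉₊ + 1) t, hα0 _, fun t => ?_⟩
  obtain ⟨N, hN⟩ := exists_nat_gt |t|
  have hev : (fun t => α (⌈|t|⌉₊ + 1) t) =ᶠ[𝓝 t] α N := by
    filter_upwards [continuous_abs.continuousAt.eventually_lt continuousAt_const hN] with u hu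
    exact hagree _ _ _ (hidx u) hu
  have h := (hα N t (abs_lt.1 hN)).congr_of_eventuallyEq hev
  rwa [← hagree _ _ _ (hidx t) hN] at h

/-! ### The function `φ` -/

section OfferPhi

variable {ν : Measure ℝ} [IsProbabilityMeasure ν]

theorem integrable_max_sub_zero (hν : Integrable (fun x : ℝ => max x 0) ν) (v : ℝ) :
    Integrable (fun x : ℝ => max (x - v) 0) ν := by
  refine (hν.add (integrable_const |v|)).mono' (by fun_prop) (ae_of_all _ fun x => ?_)
  rw [Real.norm_of_nonneg (le_max_right _ _), Pi.add_apply]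
  refine max_le ?_ (by positivity)
  linarith [le_max_left x 0, neg_abs_le v]

/-- The layer cake formula for the excess `(X - v)⁺` of an offer over `v`. -/
theorem offerPhi_eq_integral (hν : Integrable (fun x : ℝ => max x 0) ν) (v : ℝ) :
    offerPhi ν v = ∫ x, max (x - v) 0 ∂ν := by
  rw [(integrable_max_sub_zero hν v).integral_eq_integral_meas_lt
    (ae_of_all _ fun x => le_max_right _ _), offerPhi]
  rw [← (measurePreserving_add_right volume v).setIntegral_preimage_emb
    (measurableEmbedding_addRight v) (fun u => 1 - cdf ν u) (Set.Ioi v)]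
  have hpre : (fun u : ℝ => u + v) ⁻¹' Set.Ioi v = Set.Ioi 0 := by
    ext u
    simp
  rw [hpre]
  refine setIntegral_congr_fun measurableSet_Ioi fun u hu => ?_
  have hset : {a : ℝ | u < max (a - v) 0} = (Set.Iic (u + v))ᶜ := by
    ext a
    have hu' : (0 : ℝ) < u := hu
    simp only [Set.mem_ofPred_eq, lt_max_iff, hu'.not_gt, or_false, Set.mem_compl_iff, Set.mem_Iic,
      not_le, lt_sub_iff_add_lt]
  simp only [hset, probReal_compl_eq_one_sub measurableSet_Iic, cdf_eq_real]

theorem max_eq_add_max_sub (x v : ℝ) : max x v = v + max (x - v) 0 := by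
  rcases le_total x v with h | h
  · rw [max_eq_right h, max_eq_right (by linarith)]; ring
  · rw [max_eq_left h, max_eq_left (by linarith)]; ring

theorem integral_max_const (hν : Integrable (fun x : ℝ => max x 0) ν) (v : ℝ) :
    ∫ x, max x v ∂ν = v + offerPhi ν v := by
  simp only [max_eq_add_max_sub _ v]
  rw [integral_add (integrable_const v) (integrable_max_sub_zero hν v), offerPhi_eq_integral hν]
  simp

theorem offerPhi_nonneg (hν : Integrable (fun x : ℝ => max x 0) ν) (v : ℝ) :
    0 ≤ offerPhi ν v := by
  rw [offerPhi_eq_integral hν]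
  exact integral_nonneg fun x => le_max_right _ _

theorem offerPhi_antitone (hν : Integrable (fun x : ℝ => max x 0) ν) :
    Antitone (offerPhi ν) := by
  intro v w hvw
  rw [offerPhi_eq_integral hν, offerPhi_eq_integral hν]
  exact integral_mono (integrable_max_sub_zero hν w) (integrable_max_sub_zero hν v)
    fun x => max_le_max (by linarith) le_rfl

theorem lipschitzWith_offerPhi (hν : Integrable (fun x : ℝ => max x 0) ν) :
    LipschitzWith 1 (offerPhi ν) := by
  refine LipschitzWith.of_le_add fun v w => ?_
  rw [offerPhi_eq_integral hν, offerPhi_eq_integral hν]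
  calc ∫ x, max (x - v) 0 ∂ν ≤ ∫ x, (max (x - w) 0 + dist v w) ∂ν := by
        refine integral_mono (integrable_max_sub_zero hν v)
          ((integrable_max_sub_zero hν w).add (integrable_const _)) fun x => ?_
        have h : w - v ≤ dist v w := by
          rw [dist_comm, Real.dist_eq]
          exact le_abs_self _
        refine max_le ?_ (by positivity)
        linarith [le_max_left (x - w) 0]
    _ = ∫ x, max (x - w) 0 ∂ν + dist v w := by
        rw [integral_add (integrable_max_sub_zero hν w) (integrable_const _)]
        simp

theorem offerPhi_pos (hν : Integrable (fun x : ℝ => max x 0) ν) {v : ℝ}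
    (hv : (v : EReal) < offerSup ν) : 0 < offerPhi ν v := by
  obtain ⟨_, ⟨x, hx, rfl⟩, hvx⟩ := lt_sSup_iff.1 hv
  have hvx' : v < x := EReal.coe_lt_coe_iff.1 hvx
  rw [offerPhi_eq_integral hν, integral_pos_iff_support_of_nonneg
    (f := fun x => max (x - v) 0) (fun x => le_max_right _ _) (integrable_max_sub_zero hν v)]
  have hpos : 0 < ν (Set.Iic x)ᶜ := by
    rw [pos_iff_ne_zero]
    intro h0
    have h1 : ν.real (Set.Iic x)ᶜ = 0 := by rw [Measure.real, h0]; rfl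
    rw [probReal_compl_eq_one_sub measurableSet_Iic, ← cdf_eq_real] at h1
    have : cdf ν x < 1 := hx
    linarith
  refine hpos.trans_le (measure_mono fun u hu => ?_)
  have hu' : x < u := not_le.1 hu
  rw [Function.mem_support, max_eq_left (by linarith)]
  linarith

/-- Away from the atoms of the offer law, `φ' = -(1 - F)`. -/
theorem hasDerivAt_offerPhi (hν : Integrable (fun x : ℝ => max x 0) ν) {v : ℝ}
    (hv : ν {v} = 0) : HasDerivAt (offerPhi ν) (-(1 - cdf ν v)) v := by
  have hfun : offerPhi ν = fun w => ∫ x, max (x - w) 0 ∂ν := funext (offerPhi_eq_integral hν)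
  have hmeas : MeasurableSet (Set.Ioi v) := measurableSet_Ioi
  have h := hasDerivAt_integral_of_dominated_loc_of_lip (μ := ν) (s := Set.univ)
    (F := fun w x => max (x - w) 0) (F' := (Set.Ioi v).indicator fun _ => (-1 : ℝ)) (x₀ := v)
    (bound := fun _ => 1) univ_mem
    (Eventually.of_forall fun w => (integrable_max_sub_zero hν w).aestronglyMeasurable)
    (integrable_max_sub_zero hν v)
    ((measurable_const.indicator hmeas).aestronglyMeasurable)
    (ae_of_all _ fun x => ?_) (integrable_const _) ?_
  · rw [hfun]
    refine h.2.congr_deriv ?_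
    rw [integral_indicator hmeas, setIntegral_const, ← Set.compl_Iic,
      probReal_compl_eq_one_sub measurableSet_Iic, cdf_eq_real]
    simp
  · have h1 : LipschitzWith 1 fun w : ℝ => x - w := by
      simpa using LipschitzWith.of_dist_le_mul (K := 1) (f := fun w : ℝ => x - w) fun a b => by
        rw [dist_sub_left]
        simp
    simpa using (h1.max_const 0).lipschitzOnWith (s := Set.univ)
  · have hne : ∀ᵐ x ∂ν, x ≠ v := by
      rw [ae_iff]
      simpa using hv
    filter_upwards [hne] with x hx
    rcases lt_or_gt_of_ne hx with hlt | hgt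
    · have : (fun w => max (x - w) 0) =ᶠ[𝓝 v] fun _ => (0 : ℝ) := by
        filter_upwards [lt_mem_nhds hlt] with w hw
        exact max_eq_right (by linarith)
      rw [Set.indicator_of_notMem (by simpa using hlt.le)]
      exact (hasDerivAt_const v (0 : ℝ)).congr_of_eventuallyEq this
    · have : (fun w => max (x - w) 0) =ᶠ[𝓝 v] fun w => x - w := by
        filter_upwards [gt_mem_nhds hgt] with w hw
        exact max_eq_left (by linarith)
      rw [Set.indicator_of_mem (by simpa using hgt)]
      exact ((hasDerivAt_id v).const_sub x).congr_of_eventuallyEq this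

end OfferPhi

/-! ### The differential equation of the optimal value -/

/-- `m` solves `m' = rate * φ(m)`, `m 0 = μ₀` for nonnegative times, and stays below the supremum of
the offers (in the form `φ(m) > 0`). Continuity and monotonicity are required on the whole line to
have measurability for free; the values at negative times play no role. -/
structure IsValueCurve (rate : ℝ) (ν : Measure ℝ) (μ₀ : ℝ) (m : ℝ → ℝ) : Prop where
  zero : m 0 = μ₀
  continuous : Continuous m
  monotone : Monotone m
  hasDerivAt : ∀ s, 0 ≤ s → HasDerivAt m (rate * offerPhi ν (m s)) s
  offerPhi_pos : ∀ s, 0 ≤ s → 0 < offerPhi ν (m s)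

theorem exists_isValueCurve {rate : ℝ} (hrate : 0 < rate) {ν : Measure ℝ} [IsProbabilityMeasure ν]
    (hν : Integrable (fun x : ℝ => max x 0) ν) {μ₀ : ℝ} (hμ₀ : (μ₀ : EReal) < offerSup ν) :
    ∃ m, IsValueCurve rate ν μ₀ m := by
  -- Truncating the argument at `μ₀` makes the vector field bounded.
  set f : ℝ → ℝ := fun x => rate * offerPhi ν (max x μ₀) with hf
  have hf_nonneg : ∀ x, 0 ≤ f x := fun x => mul_nonneg hrate.le (offerPhi_nonneg hν _)
  have hLip : LipschitzWith rate.toNNReal f := by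
    have h1 : LipschitzWith 1 fun x : ℝ => offerPhi ν (max x μ₀) := by
      simpa [Function.comp_def] using
        (lipschitzWith_offerPhi hν).comp (LipschitzWith.id.max_const μ₀)
    refine LipschitzWith.of_dist_le_mul fun x y => ?_
    have h2 := h1.dist_le_mul x y
    rw [NNReal.coe_one, one_mul, Real.dist_eq] at h2
    rw [Real.coe_toNNReal _ hrate.le, Real.dist_eq, hf]
    simp only
    rw [← mul_sub, abs_mul, abs_of_pos hrate]
    exact mul_le_mul_of_nonneg_left h2 hrate.le
  have hbdd : ∀ x, ‖f x‖ ≤ (rate * offerPhi ν μ₀).toNNReal := fun x => by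
    rw [Real.norm_of_nonneg (hf_nonneg x),
      Real.coe_toNNReal _ (mul_nonneg hrate.le (offerPhi_nonneg hν _))]
    exact mul_le_mul_of_nonneg_left (offerPhi_antitone hν (le_max_right _ _)) hrate.le
  obtain ⟨m, hm0, hm⟩ := exists_hasDerivAt_of_lipschitzWith_of_bounded hLip hbdd μ₀
  have hmono : Monotone m := by
    refine monotone_of_deriv_nonneg (fun t => (hm t).differentiableAt) fun t => ?_
    rw [(hm t).deriv]
    exact hf_nonneg _
  have hfm : ∀ s, 0 ≤ s → f (m s) = rate * offerPhi ν (m s) := fun s hs => by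
    have : μ₀ ≤ m s := hm0 ▸ hmono hs
    simp only [hf, max_eq_left this]
  refine ⟨m, hm0, continuous_iff_continuousAt.2 fun t => (hm t).continuousAt, hmono,
    fun s hs => hfm s hs ▸ hm s, fun s hs => ?_⟩
  refine (offerPhi_nonneg hν _).lt_of_ne' fun h0 => ?_
  -- A zero of `φ` is an equilibrium, which a different solution cannot reach.
  have hconst : m = fun _ => m s := by
    refine ODE_solution_unique_univ (v := fun _ => f) (s := fun _ => Set.univ) (t₀ := s)
      (fun _ => hLip.lipschitzOnWith) (fun t => ⟨hm t, trivial⟩) (fun t => ⟨?_, trivial⟩) rfl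
    rw [hfm s hs, h0, mul_zero]
    exact hasDerivAt_const _ _
  have : m s = μ₀ := by rw [← hm0, congrFun hconst 0]
  rw [this] at h0
  exact (offerPhi_pos hν hμ₀).ne' h0

namespace IsValueCurve

variable {rate : ℝ} {ν : Measure ℝ} {μ₀ : ℝ} {m : ℝ → ℝ}

theorem le_apply (hm : IsValueCurve rate ν μ₀ m) {s : ℝ} (hs : 0 ≤ s) : μ₀ ≤ m s :=
  hm.zero ▸ hm.monotone hs

theorem strictMonoOn (hm : IsValueCurve rate ν μ₀ m) (hrate : 0 < rate) :
    StrictMonoOn m (Set.Ici 0) := by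
  refine strictMonoOn_of_deriv_pos (convex_Ici 0) hm.continuous.continuousOn fun s hs => ?_
  rw [interior_Ici] at hs
  have hs' : 0 ≤ s := le_of_lt hs
  rw [(hm.hasDerivAt s hs').deriv]
  exact mul_pos hrate (hm.offerPhi_pos s hs')

end IsValueCurve

/-! ### Conditioning on the first offer -/

theorem ae_pos_expMeasure {rate : ℝ} (hrate : 0 < rate) : ∀ᵐ d ∂expMeasure rate, 0 < d := by
  have := isProbabilityMeasure_expMeasure hrate
  have h : (expMeasure rate).real (Set.Iic 0) = 0 := by
    rw [← cdf_eq_real, cdf_expMeasure_eq hrate]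
    simp
  rw [ae_iff]
  simpa [Set.Iic_def] using (measureReal_eq_zero_iff).1 h

theorem integral_expMeasure {rate : ℝ} (hrate : 0 < rate) (f : ℝ → ℝ) :
    ∫ d, f d ∂expMeasure rate = ∫ d in Set.Ioi 0, rate * Real.exp (-(rate * d)) * f d := by
  have h1 : ∫ d, f d ∂expMeasure rate = ∫ d, exponentialPDFReal rate d * f d := by
    have h := integral_withDensity_eq_integral_toReal_smul (μ := volume)
      (f := exponentialPDF rate) (by unfold exponentialPDF; fun_prop)
      (ae_of_all _ fun x => by simp [exponentialPDF]) f
    refine h.trans (integral_congr_ae (ae_of_all _ fun d => ?_))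
    simp only [exponentialPDF, smul_eq_mul,
      ENNReal.toReal_ofReal (exponentialPDFReal_nonneg hrate d)]
  rw [h1, ← integral_indicator measurableSet_Ioi]
  refine integral_congr_ae ?_
  filter_upwards [Measure.ae_ne volume (0 : ℝ)] with d hd
  rcases lt_or_gt_of_ne hd with h | h
  · rw [Set.indicator_of_notMem (by simpa using h.le), exponentialPDFReal, gammaPDFReal,
      if_neg h.not_ge, zero_mul]
  · rw [Set.indicator_of_mem (by simpa using h), exponentialPDFReal, gammaPDFReal, if_pos h.le]
    simp

theorem expMeasure_absolutelyContinuous (rate : ℝ) : expMeasure rate ≪ volume :=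
  withDensity_absolutelyContinuous _ _

/-- If `k' = rate * (b - k)` beyond `c`, then `k` is the expectation of the process that waits for
an exponential time `d` while the time left `s` decreases, and then pays `b (s - d)`, or pays `k c`
if the level `c` is reached before. -/
theorem integral_expMeasure_of_hasDerivAt {rate : ℝ} (hrate : 0 < rate) {k b : ℝ → ℝ} {c : ℝ}
    {Z : Set ℝ} (hZ : Z.Countable) (hk : ContinuousOn k (Set.Ici c))
    (hderiv : ∀ w, c < w → w ∉ Z → HasDerivAt k (rate * (b w - k w)) w)
    (hb : Measurable b) {s C : ℝ} (hC : ∀ w, c < w → w ≤ s → |b w| ≤ C) :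
    ∫ d, (if c < s - d then b (s - d) else k c) ∂expMeasure rate = k (max s c) := by
  have := isProbabilityMeasure_expMeasure hrate
  rcases le_or_gt s c with hsc | hsc
  · have h : ∀ᵐ d ∂expMeasure rate, (if c < s - d then b (s - d) else k c) = k c := by
      filter_upwards [ae_pos_expMeasure hrate] with d hd
      rw [if_neg (by linarith)]
    rw [integral_congr_ae h, max_eq_right hsc]
    simp
  rw [max_eq_left hsc.le]
  have hbs : Measurable fun d => b (s - d) := hb.comp (by fun_prop)
  have hIio : MeasurableSet (Set.Iio (s - c)) := measurableSet_Iio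
  have hsplit : ∀ d, (if c < s - d then b (s - d) else k c)
      = k c + (Set.Iio (s - c)).indicator (fun d => b (s - d) - k c) d := fun d => by
    by_cases h : d < s - c
    · rw [if_pos (by linarith), Set.indicator_of_mem (by simpa using h)]
      ring
    · rw [if_neg (by linarith), Set.indicator_of_notMem (by simpa using h), add_zero]
  have hint : Integrable ((Set.Iio (s - c)).indicator fun d => b (s - d) - k c)
      (expMeasure rate) := by
    refine Integrable.of_bound (C := C + |k c|)
      ((hbs.sub_const _).indicator hIio).aestronglyMeasurable ?_
    filter_upwards [ae_pos_expMeasure hrate] with d hd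
    by_cases h : d < s - c
    · rw [Set.indicator_of_mem (by simpa using h), Real.norm_eq_abs]
      exact (abs_sub _ _).trans (by gcongr; exact hC _ (by linarith) (by linarith))
    · rw [Set.indicator_of_notMem (by simpa using h), norm_zero]
      have := (abs_nonneg _).trans (hC s hsc le_rfl)
      positivity
  simp only [hsplit]
  rw [integral_add (integrable_const _) hint, integral_expMeasure hrate (Set.indicator _ _)]
  have hae : ∫ d in Set.Ioi 0, rate * Real.exp (-(rate * d)) *
        (Set.Iio (s - c)).indicator (fun d => b (s - d) - k c) d
      = ∫ d in (0 : ℝ)..(s - c), rate * Real.exp (-(rate * d)) * (b (s - d) - k c) := by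
    rw [intervalIntegral.integral_of_le (by linarith), ← integral_indicator measurableSet_Ioi,
      ← integral_indicator measurableSet_Ioc]
    refine integral_congr_ae ?_
    filter_upwards [Measure.ae_ne volume (s - c)] with d hd
    simp only [Set.indicator, Set.mem_Ioi, Set.mem_Iio, Set.mem_Ioc, le_iff_lt_or_eq, hd, or_false]
    split_ifs <;> first | rfl | simp_all
  rw [hae]
  have hFTC := MeasureTheory.integral_eq_of_hasDerivAt_off_countable_of_le
    (fun d => -(Real.exp (-(rate * d)) * (k (s - d) - k c)))
    (fun d => rate * Real.exp (-(rate * d)) * (b (s - d) - k c))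
    (a := 0) (b := s - c) (by linarith) (s := (fun d => s - d) ⁻¹' Z)
    (hZ.preimage (sub_right_injective)) ?_ ?_ ?_
  · rw [hFTC]
    simp
  · refine ContinuousOn.neg
      (ContinuousOn.mul (by fun_prop) (ContinuousOn.sub ?_ continuousOn_const))
    refine hk.comp (by fun_prop) fun d hd => ?_
    simp only [Set.mem_Ici]
    linarith [hd.2]
  · rintro d ⟨⟨hd0, hd1⟩, hdZ⟩
    have h1 : HasDerivAt (fun d => k (s - d)) (-(rate * (b (s - d) - k (s - d)))) d := by
      have := (hderiv (s - d) (by linarith) hdZ).comp d ((hasDerivAt_id d).const_sub s)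
      simpa [Function.comp_def] using this
    have h2 : HasDerivAt (fun d => Real.exp (-(rate * d))) (Real.exp (-(rate * d)) * -rate) d := by
      have := (((hasDerivAt_id d).const_mul rate).neg).exp
      simpa using this
    refine (h2.mul (h1.sub_const (k c))).neg.congr_deriv ?_
    ring
  · refine (intervalIntegrable_iff_integrableOn_Ioo_of_le (by linarith)).2 ?_
    refine Measure.integrableOn_of_bounded (M := rate * (C + |k c|)) (by simp)
      (Measurable.aestronglyMeasurable (by fun_prop)) ?_
    filter_upwards [ae_restrict_mem measurableSet_Ioo] with d hd
    have hd0 := hd.1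
    have hd1 := hd.2
    rw [Real.norm_eq_abs, abs_mul, abs_mul, abs_of_pos hrate, Real.abs_exp]
    have he : Real.exp (-(rate * d)) ≤ 1 := Real.exp_le_one_iff.2 (by nlinarith)
    calc rate * Real.exp (-(rate * d)) * |b (s - d) - k c| ≤ rate * 1 * (C + |k c|) := by
          gcongr
          exact (abs_sub _ _).trans (by gcongr; exact hC _ (by linarith) (by linarith))
      _ = rate * (C + |k c|) := by ring

theorem countable_setOfPred_singleton_pos (ν : Measure ℝ) [IsProbabilityMeasure ν] :
    {x : ℝ | 0 < ν {x}}.Countable :=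
  Measure.countable_meas_pos_of_disjoint_of_meas_iUnion_ne_top ν
    (fun x => measurableSet_singleton x)
    (fun x y hxy => by simpa [Function.onFun] using hxy) (measure_ne_top _ _)

/-- With time `s` left, the value after the next offer, of size `x` and arriving after a duration
`d`, for a seller who takes the better of the offer and the value `m` of continuing. -/
noncomputable def nextValue (m : ℝ → ℝ) (s d x : ℝ) : ℝ :=
  if 0 < s - d then max x (m (s - d)) else m 0

/-- An offer `x` that arrives with time `s` left is accepted by the rule with threshold `m`, before
the deadline and not below the level `c` of the time left. Both `0 < s` and `c ≤ s` are required, so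
that `c = 0` describes a sale at any time and `c > 0` a sale at a time left of at least `c`. -/
def AcceptsBy (m : ℝ → ℝ) (c s x : ℝ) : Prop := 0 < s ∧ c ≤ s ∧ m s ≤ x

theorem measurableSet_acceptsBy {m : ℝ → ℝ} (hm : Measurable m) (c : ℝ) :
    MeasurableSet {p : ℝ × ℝ | AcceptsBy m c p.1 p.2} := by
  have h1 : MeasurableSet {p : ℝ × ℝ | 0 < p.1} := measurableSet_lt measurable_const measurable_fst
  have h2 : MeasurableSet {p : ℝ × ℝ | c ≤ p.1} := measurableSet_le measurable_const measurable_fst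
  have h3 : MeasurableSet {p : ℝ × ℝ | m p.1 ≤ p.2} :=
    measurableSet_le (hm.comp measurable_fst) measurable_snd
  exact h1.inter (h2.inter h3)

open Classical in
/-- With time `s` left, the value `φ (m ·)` at the next offer, stopped at the level `c`, and killed
if the offer is accepted. -/
noncomputable def nextSurvival (ν : Measure ℝ) (m : ℝ → ℝ) (c s d x : ℝ) : ℝ :=
  if AcceptsBy m c (max (s - d) 0) x then 0 else offerPhi ν (m (max (max (s - d) 0) c))

namespace IsValueCurve

variable {rate : ℝ} {ν : Measure ℝ} {μ₀ : ℝ} {m : ℝ → ℝ}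

theorem measurable_nextValue (hm : IsValueCurve rate ν μ₀ m) :
    Measurable fun p : ℝ × ℝ × ℝ => nextValue m p.1 p.2.1 p.2.2 := by
  have hmm := hm.continuous.measurable
  unfold nextValue
  refine Measurable.ite (measurableSet_lt (by fun_prop) (by fun_prop)) ?_ (by fun_prop)
  fun_prop

theorem abs_nextValue_le (hm : IsValueCurve rate ν μ₀ m) (hμ₀ : 0 ≤ μ₀) {s d : ℝ} (hs : 0 ≤ s)
    (hd : 0 < d) (x : ℝ) : |nextValue m s d x| ≤ max x 0 + m s := by
  have h0 : 0 ≤ m s := hμ₀.trans (hm.le_apply hs)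
  have hx : 0 ≤ max x 0 := le_max_right _ _
  unfold nextValue
  split_ifs with h
  · have h1 : 0 ≤ m (s - d) := hμ₀.trans (hm.le_apply h.le)
    have h2 : m (s - d) ≤ m s := hm.monotone (by linarith)
    rw [abs_of_nonneg (h1.trans (le_max_right _ _))]
    exact max_le (by linarith [le_max_left x 0]) (by linarith)
  · rw [hm.zero, abs_of_nonneg hμ₀]
    linarith [hm.le_apply hs]

/-- The dynamic programming equation for the optimal value. -/
theorem integral_nextValue [IsProbabilityMeasure ν] (hm : IsValueCurve rate ν μ₀ m)
    (hrate : 0 < rate)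
    (hν : Integrable (fun x : ℝ => max x 0) ν) (hμ₀ : 0 ≤ μ₀) {s : ℝ} (hs : 0 ≤ s) :
    ∫ p, nextValue m s p.1 p.2 ∂((expMeasure rate).prod ν) = m s := by
  have := isProbabilityMeasure_expMeasure hrate
  have hmm := hm.continuous.measurable
  have hφ := (lipschitzWith_offerPhi hν).continuous
  have hint : Integrable (fun p : ℝ × ℝ => nextValue m s p.1 p.2) ((expMeasure rate).prod ν) := by
    have hdom : Integrable (fun p : ℝ × ℝ => max p.2 0 + m s) ((expMeasure rate).prod ν) :=
      (hν.comp_snd _).add (integrable_const _)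
    refine hdom.mono'
      (hm.measurable_nextValue.comp (by fun_prop : Measurable fun p : ℝ × ℝ => (s, p.1, p.2))
        ).aestronglyMeasurable ?_
    have h1 : ∀ᵐ p ∂(expMeasure rate).prod ν, 0 < p.1 :=
      Measure.quasiMeasurePreserving_fst.ae (ae_pos_expMeasure hrate)
    filter_upwards [h1] with p hp
    exact hm.abs_nextValue_le hμ₀ hs hp _
  rw [integral_prod _ hint]
  have hinner : ∀ d, ∫ x, nextValue m s d x ∂ν
      = if 0 < s - d then m (s - d) + offerPhi ν (m (s - d)) else m 0 := fun d => by
    unfold nextValue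
    split_ifs with h
    · exact integral_max_const hν _
    · simp
  simp only [hinner]
  have h := integral_expMeasure_of_hasDerivAt hrate (k := m)
    (b := fun w => m w + offerPhi ν (m w)) (c := 0) (Z := ∅) Set.countable_empty
    hm.continuous.continuousOn (fun w hw _ => ?_) (hmm.add (hφ.measurable.comp hmm)) (s := s)
    (C := m s + offerPhi ν μ₀) fun w hw hws => ?_
  · rw [h, max_eq_left hs]
  · refine (hm.hasDerivAt w hw.le).congr_deriv ?_
    ring
  · have h1 := hm.le_apply hw.le
    have h2 := offerPhi_nonneg hν (m w)
    have h3 := offerPhi_antitone hν h1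
    rw [abs_of_nonneg (by linarith)]
    linarith [hm.monotone hws]

theorem measurable_nextSurvival [IsProbabilityMeasure ν] (hm : IsValueCurve rate ν μ₀ m)
    (hν : Integrable (fun x : ℝ => max x 0) ν) (c : ℝ) :
    Measurable fun p : ℝ × ℝ × ℝ => nextSurvival ν m c p.1 p.2.1 p.2.2 := by
  have hmm := hm.continuous.measurable
  have hφ := (lipschitzWith_offerPhi hν).continuous.measurable
  have hset : MeasurableSet {p : ℝ × ℝ × ℝ | AcceptsBy m c (max (p.1 - p.2.1) 0) p.2.2} :=
    (by fun_prop : Measurable fun p : ℝ × ℝ × ℝ => (max (p.1 - p.2.1) 0, p.2.2))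
      (measurableSet_acceptsBy hmm c)
  exact Measurable.ite hset (by fun_prop) (hφ.comp (hmm.comp (by fun_prop)))

theorem abs_nextSurvival_le [IsProbabilityMeasure ν] (hm : IsValueCurve rate ν μ₀ m)
    (hν : Integrable (fun x : ℝ => max x 0) ν) (c s d x : ℝ) :
    |nextSurvival ν m c s d x| ≤ offerPhi ν μ₀ := by
  unfold nextSurvival
  split_ifs
  · simpa using offerPhi_nonneg hν μ₀
  · rw [abs_of_nonneg (offerPhi_nonneg hν _)]
    exact offerPhi_antitone hν (hm.le_apply ((le_max_right _ _).trans (le_max_left _ _)))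

/-- `φ(m(s))` is an eigenfunction of the process killed at the first acceptance: the derivative
of `φ(m(s))` in `s` is `-rate * (1 - F(m(s))) * φ(m(s))` for all but countably many `s`, and
`rate * (1 - F(m(s)))` is the rate of acceptance. -/
theorem integral_nextSurvival [IsProbabilityMeasure ν] (hm : IsValueCurve rate ν μ₀ m)
    (hrate : 0 < rate)
    (hν : Integrable (fun x : ℝ => max x 0) ν) {c : ℝ} (hc : 0 ≤ c) (s : ℝ) :
    ∫ p, nextSurvival ν m c s p.1 p.2 ∂((expMeasure rate).prod ν) = offerPhi ν (m (max s c)) := by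
  have := isProbabilityMeasure_expMeasure hrate
  have hmm := hm.continuous.measurable
  have hφ := (lipschitzWith_offerPhi hν).continuous
  have hint : Integrable (fun p : ℝ × ℝ => nextSurvival ν m c s p.1 p.2)
      ((expMeasure rate).prod ν) :=
    Integrable.of_bound
      ((hm.measurable_nextSurvival hν c).comp
        (by fun_prop : Measurable fun p : ℝ × ℝ => (s, p.1, p.2))).aestronglyMeasurable _
      (ae_of_all _ fun p => hm.abs_nextSurvival_le hν c s p.1 p.2)
  rw [integral_prod _ hint]
  have hinner : (fun d => ∫ x, nextSurvival ν m c s d x ∂ν) =ᵐ[expMeasure rate] fun d =>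
      if c < s - d then ν.real (Set.Iio (m (s - d))) * offerPhi ν (m (s - d))
      else offerPhi ν (m c) := by
    filter_upwards [(expMeasure_absolutelyContinuous rate).ae_le (Measure.ae_ne volume (s - c))]
      with d hd
    split_ifs with h
    · have hmax : max (s - d) 0 = s - d := max_eq_left (hc.trans h.le)
      have hfun : (fun x => nextSurvival ν m c s d x)
          = (Set.Iio (m (s - d))).indicator fun _ => offerPhi ν (m (s - d)) := by
        ext x
        simp only [nextSurvival, AcceptsBy, hmax, max_eq_left h.le, hc.trans_lt h, h.le, true_and,
          Set.indicator, Set.mem_Iio, ← not_lt, ite_not]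
      rw [hfun, integral_indicator measurableSet_Iio, setIntegral_const, smul_eq_mul]
    · -- Only `s - d < c` is left, since `d = s - c` has probability zero.
      have hlt : s - d < c := lt_of_le_of_ne (not_lt.1 h) fun h' => hd (by linarith)
      have hna : ∀ x, ¬ AcceptsBy m c (max (s - d) 0) x := by
        rintro x ⟨h1, h2, -⟩
        rcases le_total (s - d) 0 with h3 | h3
        · rw [max_eq_right h3] at h1
          exact lt_irrefl _ h1
        · rw [max_eq_left h3] at h2
          linarith
      simp only [nextSurvival, if_neg (hna _), max_eq_right (max_le hlt.le hc)]
      simp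
  rw [integral_congr_ae hinner]
  have hinj : Set.InjOn m (Set.Ici 0) := (hm.strictMonoOn hrate).injOn
  have hZ : (Set.Ici 0 ∩ m ⁻¹' {x : ℝ | 0 < ν {x}}).Countable :=
    Set.MapsTo.countable_of_injOn (f := m) (fun w hw => hw.2) (hinj.mono Set.inter_subset_left)
      (countable_setOfPred_singleton_pos ν)
  have hIio : Monotone fun v => ν.real (Set.Iio v) := fun v w hvw =>
    measureReal_mono (Set.Iio_subset_Iio hvw)
  refine integral_expMeasure_of_hasDerivAt hrate (k := fun w => offerPhi ν (m w))
    (b := fun w => ν.real (Set.Iio (m w)) * offerPhi ν (m w)) hZ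
    (hφ.comp hm.continuous).continuousOn (fun w hw hwZ => ?_)
    ((hIio.measurable.comp hmm).mul (hφ.measurable.comp hmm)) (C := offerPhi ν μ₀) fun w hw _ => ?_
  · have hw0 : 0 ≤ w := hc.trans hw.le
    have hatom : ν {m w} = 0 := by
      by_contra h
      exact hwZ ⟨hw0, pos_iff_ne_zero.2 h⟩
    have hF : ν.real (Set.Iio (m w)) = cdf ν (m w) := by
      rw [cdf_eq_real]
      exact measureReal_congr (Iio_ae_eq_Iic' hatom)
    refine ((hasDerivAt_offerPhi hν hatom).comp w (hm.hasDerivAt w hw0)).congr_deriv ?_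
    rw [hF]
    ring
  · have h1 := offerPhi_nonneg hν (m w)
    rw [abs_of_nonneg (mul_nonneg measureReal_nonneg h1)]
    calc ν.real (Set.Iio (m w)) * offerPhi ν (m w) ≤ 1 * offerPhi ν μ₀ := by
          gcongr
          · exact measureReal_le_one
          · exact offerPhi_antitone hν (hm.le_apply (hc.trans hw.le))
      _ = offerPhi ν μ₀ := one_mul _

end IsValueCurve

namespace BiddingProcess

variable {Ω : Type*} [MeasurableSpace Ω] {P : Measure Ω} {rate : ℝ} {ν ν₀ : Measure ℝ}

/-! ### The past of an offer, and its independence of the offer -/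

/-- The information available just before the `n`-th duration starts: unlike `history`, this is
indexed so that the past of the first offer is trivial. -/
@[reducible] def past (B : BiddingProcess P rate ν ν₀) (n : ℕ) : MeasurableSpace Ω :=
  ⨆ k, ⨆ (_ : k < n),
    MeasurableSpace.comap (B.D k) inferInstance ⊔ MeasurableSpace.comap (B.X k) inferInstance

theorem history_eq_past (B : BiddingProcess P rate ν ν₀) (n : ℕ) :
    B.history n = B.past (n + 1) := by
  simp only [past, Nat.lt_succ_iff, ← MeasurableSpace.comap_prodMk]
  rfl

theorem past_mono (B : BiddingProcess P rate ν ν₀) : Monotone B.past := fun _ _ hnm =>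
  iSup_mono fun _ => iSup_mono' fun hk => ⟨hk.trans_le hnm, le_rfl⟩

theorem past_le (B : BiddingProcess P rate ν ν₀) (n : ℕ) :
    B.past n ≤ (inferInstance : MeasurableSpace Ω) :=
  iSup₂_le fun k _ => sup_le (B.measurable_D k).comap_le (B.measurable_X k).comap_le

theorem measurable_past_D (B : BiddingProcess P rate ν ν₀) {k n : ℕ} (hk : k < n) :
    Measurable[B.past n] (B.D k) := by
  refine (comap_measurable (B.D k)).mono ?_ le_rfl
  exact le_iSup₂_of_le (f := fun k (_ : k < n) => MeasurableSpace.comap (B.D k) inferInstance ⊔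
    MeasurableSpace.comap (B.X k) inferInstance) k hk le_sup_left

theorem measurable_past_X (B : BiddingProcess P rate ν ν₀) {k n : ℕ} (hk : k < n) :
    Measurable[B.past n] (B.X k) := by
  refine (comap_measurable (B.X k)).mono ?_ le_rfl
  exact le_iSup₂_of_le (f := fun k (_ : k < n) => MeasurableSpace.comap (B.D k) inferInstance ⊔
    MeasurableSpace.comap (B.X k) inferInstance) k hk le_sup_right

theorem measurable_past_timeLeft (B : BiddingProcess P rate ν ν₀) (t : ℝ) (n : ℕ) :
    Measurable[B.past n] (B.timeLeft t n) := by
  induction n with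
  | zero => exact measurable_const
  | succ n ih =>
    exact Measurable.max (Measurable.sub (ih.mono (B.past_mono n.le_succ) le_rfl)
      (B.measurable_past_D n.lt_succ_self)) measurable_const

theorem measurable_timeLeft (B : BiddingProcess P rate ν ν₀) (t : ℝ) (n : ℕ) :
    Measurable (B.timeLeft t n) :=
  (B.measurable_past_timeLeft t n).mono (B.past_le n) le_rfl

/-- The σ-algebras generated by the single random variables, in the order in which
`BiddingProcess.indep` lists the variables. -/
theorem iIndep_comap (B : BiddingProcess P rate ν ν₀) :
    iIndep (fun i => MeasurableSpace.comap (Sum.elim B.D (Sum.elim B.X fun _ : Unit => B.X₀) i)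
      inferInstance) P :=
  (iIndepFun_iff_iIndep _ _ _).1 B.indep

theorem comap_sum_elim_le (B : BiddingProcess P rate ν ν₀) (i : ℕ ⊕ ℕ ⊕ Unit) :
    MeasurableSpace.comap (Sum.elim B.D (Sum.elim B.X fun _ : Unit => B.X₀) i) inferInstance
      ≤ (inferInstance : MeasurableSpace Ω) := by
  rcases i with k | k | _
  · exact (B.measurable_D k).comap_le
  · exact (B.measurable_X k).comap_le
  · exact B.measurable_X₀.comap_le

theorem past_le_iSup (B : BiddingProcess P rate ν ν₀) (n : ℕ) {S : Set (ℕ ⊕ ℕ ⊕ Unit)}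
    (hD : ∀ k < n, Sum.inl k ∈ S) (hX : ∀ k < n, Sum.inr (Sum.inl k) ∈ S) :
    B.past n ≤ ⨆ i ∈ S, MeasurableSpace.comap
      (Sum.elim B.D (Sum.elim B.X fun _ : Unit => B.X₀) i) inferInstance := by
  refine iSup₂_le fun k hk => sup_le ?_ ?_
  · exact le_iSup₂_of_le (f := fun i (_ : i ∈ S) => MeasurableSpace.comap
      (Sum.elim B.D (Sum.elim B.X fun _ : Unit => B.X₀) i) inferInstance) _ (hD k hk) le_rfl
  · exact le_iSup₂_of_le (f := fun i (_ : i ∈ S) => MeasurableSpace.comap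
      (Sum.elim B.D (Sum.elim B.X fun _ : Unit => B.X₀) i) inferInstance) _ (hX k hk) le_rfl

theorem indep_past_offer (B : BiddingProcess P rate ν ν₀) (n : ℕ) :
    Indep (B.past n) (MeasurableSpace.comap (fun ω => (B.D n ω, B.X n ω)) inferInstance) P := by
  have h := indep_iSup_of_disjoint B.comap_sum_elim_le B.iIndep_comap
    (S := {i | i ≠ Sum.inl n ∧ i ≠ Sum.inr (Sum.inl n)}) (T := {Sum.inl n, Sum.inr (Sum.inl n)}) ?_
  · refine indep_of_indep_of_le_left (indep_of_indep_of_le_right h ?_)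
      (B.past_le_iSup n (fun k hk => ?_) fun k hk => ?_)
    · refine (MeasurableSpace.comap_prodMk _ _).le.trans (sup_le ?_ ?_)
      · exact le_iSup₂_of_le (f := fun i (_ : i ∈ ({Sum.inl n, Sum.inr (Sum.inl n)} : Set _)) =>
          MeasurableSpace.comap (Sum.elim B.D (Sum.elim B.X fun _ : Unit => B.X₀) i) inferInstance)
          (Sum.inl n) (by simp) le_rfl
      · exact le_iSup₂_of_le (f := fun i (_ : i ∈ ({Sum.inl n, Sum.inr (Sum.inl n)} : Set _)) =>
          MeasurableSpace.comap (Sum.elim B.D (Sum.elim B.X fun _ : Unit => B.X₀) i) inferInstance)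
          (Sum.inr (Sum.inl n)) (by simp) le_rfl
    · simpa using hk.ne
    · simpa using hk.ne
  · rw [Set.disjoint_left]
    rintro i ⟨h1, h2⟩ (h3 | h3)
    · exact h1 h3
    · exact h2 h3

theorem indep_iSup_past_residual (B : BiddingProcess P rate ν ν₀) :
    Indep (⨆ n, B.past n) (MeasurableSpace.comap B.X₀ inferInstance) P := by
  have h := indep_iSup_of_disjoint B.comap_sum_elim_le B.iIndep_comap
    (S := {i | i ≠ Sum.inr (Sum.inr ())}) (T := {Sum.inr (Sum.inr ())}) ?_
  · refine indep_of_indep_of_le_left (indep_of_indep_of_le_right h ?_)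
      (iSup_le fun n => B.past_le_iSup n (fun k hk => by simp) fun k hk => by simp)
    simp
  · rw [Set.disjoint_left]
    exact fun i h1 h2 => h1 h2

theorem map_offer [IsProbabilityMeasure P] (B : BiddingProcess P rate ν ν₀) (n : ℕ) :
    P.map (fun ω => (B.D n ω, B.X n ω)) = (expMeasure rate).prod ν := by
  have h : IndepFun (B.D n) (B.X n) P :=
    B.indep.indepFun (i := Sum.inl n) (j := Sum.inr (Sum.inl n)) (by simp)
  rw [h.map_prod_eq_prod_map_map (B.measurable_D n).aemeasurable (B.measurable_X n).aemeasurable,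
    B.law_D, B.law_X]

theorem timeLeft_nonneg (B : BiddingProcess P rate ν ν₀) {t : ℝ} (ht : 0 ≤ t) (n : ℕ) (ω : Ω) :
    0 ≤ B.timeLeft t n ω := by
  cases n with
  | zero => exact ht
  | succ n => exact le_max_right _ _

/-- The Markov property: on an event of the past, the `n`-th duration and the `n`-th offer may be
integrated out first, with the time left before them held fixed. -/
theorem setIntegral_next_eq [IsProbabilityMeasure P] (hrate : 0 < rate) [IsProbabilityMeasure ν]
    (B : BiddingProcess P rate ν ν₀) {t : ℝ} (ht : 0 ≤ t) {n : ℕ} {A : Set Ω}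
    (hA : MeasurableSet[B.past n] A) {g : ℝ → ℝ → ℝ → ℝ}
    (hg : Measurable fun p : ℝ × ℝ × ℝ => g p.1 p.2.1 p.2.2) {k : ℝ → ℝ}
    (hk : ∀ s, 0 ≤ s → ∫ p, g s p.1 p.2 ∂((expMeasure rate).prod ν) = k s)
    (hint : IntegrableOn (fun ω => g (B.timeLeft t n ω) (B.D n ω) (B.X n ω)) A P) :
    ∫ ω in A, g (B.timeLeft t n ω) (B.D n ω) (B.X n ω) ∂P = ∫ ω in A, k (B.timeLeft t n ω) ∂P := by
  have := isProbabilityMeasure_expMeasure hrate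
  have hA' : MeasurableSet A := B.past_le n _ hA
  set Z : Ω → ℝ × ℝ := fun ω => (A.indicator (fun _ => 1) ω, B.timeLeft t n ω) with hZ
  set Y : Ω → ℝ × ℝ := fun ω => (B.D n ω, B.X n ω) with hY
  have hZp : Measurable[B.past n] Z :=
    (measurable_const.indicator hA).prodMk (B.measurable_past_timeLeft t n)
  have hZm : Measurable Z := hZp.mono (B.past_le n) le_rfl
  have hYm : Measurable Y := (B.measurable_D n).prodMk (B.measurable_X n)
  have hindep : IndepFun Z Y P :=
    (IndepFun_iff_Indep _ _ _).2 (indep_of_indep_of_le_left (B.indep_past_offer n) hZp.comap_le)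
  have hmap : P.map (fun ω => (Z ω, Y ω)) = (P.map Z).prod ((expMeasure rate).prod ν) := by
    rw [hindep.map_prod_eq_prod_map_map hZm.aemeasurable hYm.aemeasurable, hY, B.map_offer]
  set G : (ℝ × ℝ) × ℝ × ℝ → ℝ := fun q => q.1.1 * g q.1.2 q.2.1 q.2.2 with hG
  have hGm : Measurable G :=
    (by fun_prop : Measurable fun q : (ℝ × ℝ) × ℝ × ℝ => q.1.1).mul
      (hg.comp (by fun_prop : Measurable fun q : (ℝ × ℝ) × ℝ × ℝ => (q.1.2, q.2.1, q.2.2)))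
  have hZY : Measurable fun ω => (Z ω, Y ω) := hZm.prodMk hYm
  have hind : ∀ f : Ω → ℝ, (fun ω => (Z ω).1 * f ω) = A.indicator f := fun f => by
    ext ω
    by_cases hω : ω ∈ A <;> simp [hZ, hω]
  have hGint : Integrable G ((P.map Z).prod ((expMeasure rate).prod ν)) := by
    rw [← hmap, integrable_map_measure hGm.aestronglyMeasurable hZY.aemeasurable]
    have : (G ∘ fun ω => (Z ω, Y ω))
        = A.indicator fun ω => g (B.timeLeft t n ω) (B.D n ω) (B.X n ω) := hind _
    rw [this, integrable_indicator_iff hA']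
    exact hint
  have : IsProbabilityMeasure (P.map Z) := Measure.isProbabilityMeasure_map hZm.aemeasurable
  calc ∫ ω in A, g (B.timeLeft t n ω) (B.D n ω) (B.X n ω) ∂P
      = ∫ ω, G (Z ω, Y ω) ∂P := by
        rw [← integral_indicator hA', ← hind]
    _ = ∫ q, G q ∂((P.map Z).prod ((expMeasure rate).prod ν)) := by
        rw [← hmap, integral_map hZY.aemeasurable hGm.aestronglyMeasurable]
    _ = ∫ z, ∫ y, G (z, y) ∂((expMeasure rate).prod ν) ∂(P.map Z) := integral_prod _ hGint
    _ = ∫ ω, ∫ y, G (Z ω, y) ∂((expMeasure rate).prod ν) ∂P :=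
        integral_map hZm.aemeasurable
          hGm.stronglyMeasurable.integral_prod_right.aestronglyMeasurable
    _ = ∫ ω, (Z ω).1 * k (B.timeLeft t n ω) ∂P := by
        refine integral_congr_ae (ae_of_all _ fun ω => ?_)
        simp only [hG]
        rw [integral_const_mul, hk _ (B.timeLeft_nonneg ht n ω)]
    _ = ∫ ω in A, k (B.timeLeft t n ω) ∂P := by
        rw [hind, integral_indicator hA']

/-! ### The time left to the deadline -/

theorem ae_D_pos (hrate : 0 < rate) (B : BiddingProcess P rate ν ν₀) :
    ∀ᵐ ω ∂P, ∀ n, 0 < B.D n ω := by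
  refine ae_all_iff.2 fun n => ?_
  have h := ae_pos_expMeasure hrate
  rw [← B.law_D n] at h
  exact ae_of_ae_map (B.measurable_D n).aemeasurable h

theorem timeLeft_antitone (B : BiddingProcess P rate ν ν₀) {t : ℝ} (ht : 0 ≤ t) {ω : Ω}
    (hD : ∀ n, 0 < B.D n ω) : Antitone fun n => B.timeLeft t n ω :=
  antitone_nat_of_succ_le fun n =>
    max_le (by linarith [hD n]) (B.timeLeft_nonneg ht n ω)

/-- Almost surely some duration is longer than `t`, and after it no time is left. -/
theorem ae_eventually_timeLeft_eq_zero [IsProbabilityMeasure P] (hrate : 0 < rate)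
    (B : BiddingProcess P rate ν ν₀) {t : ℝ} (ht : 0 ≤ t) :
    ∀ᵐ ω ∂P, ∀ᶠ n in atTop, B.timeLeft t n ω = 0 := by
  have := isProbabilityMeasure_expMeasure hrate
  have hlong : P {ω | ∀ n, B.D n ω ≤ t} = 0 := by
    have hp : expMeasure rate (Set.Iic t) < 1 := by
      have h : (expMeasure rate).real (Set.Iic t) < 1 := by
        rw [← cdf_eq_real, cdf_expMeasure_eq hrate, if_pos ht]
        linarith [Real.exp_pos (-(rate * t))]
      rw [← ENNReal.toReal_lt_toReal (measure_ne_top _ _) ENNReal.one_ne_top]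
      simpa [Measure.real] using h
    have hle : ∀ n : ℕ, P {ω | ∀ n, B.D n ω ≤ t} ≤ expMeasure rate (Set.Iic t) ^ n := fun n => by
      have hD : iIndepFun B.D P := B.indep.precomp (g := Sum.inl) Sum.inl_injective
      have h := hD.meas_biInter (S := Finset.range n) (s := fun k => B.D k ⁻¹' Set.Iic t)
        fun k _ => ⟨_, measurableSet_Iic, rfl⟩
      have h1 : ∀ k, P (B.D k ⁻¹' Set.Iic t) = expMeasure rate (Set.Iic t) := fun k => by
        rw [← B.law_D k, Measure.map_apply (B.measurable_D k) measurableSet_Iic]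
      simp only [h1, Finset.prod_const, Finset.card_range] at h
      rw [← h]
      exact measure_mono fun ω hω => Set.mem_iInter₂.2 fun k _ => hω k
    exact le_antisymm (ge_of_tendsto' (ENNReal.tendsto_pow_atTop_nhds_zero_of_lt_one hp) hle)
      bot_le
  have hlong' : ∀ᵐ ω ∂P, ¬ ∀ n, B.D n ω ≤ t := by
    rw [ae_iff]
    simpa using hlong
  filter_upwards [B.ae_D_pos hrate, hlong'] with ω hD hω
  obtain ⟨k, hk⟩ := not_forall.1 hω
  have hanti := B.timeLeft_antitone ht hD
  refine eventually_atTop.2 ⟨k + 1, fun n hn => le_antisymm ?_ (B.timeLeft_nonneg ht n ω)⟩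
  refine (hanti hn).trans (max_le ?_ le_rfl)
  have : B.timeLeft t k ω ≤ t := hanti (Nat.zero_le k)
  linarith [not_le.1 hk]

end BiddingProcess

open Classical in
/-- A random variable selected by the index of the one event that occurs is measurable. -/
theorem measurable_dite_choose {Ω : Type*} [MeasurableSpace Ω] {E : ℕ → Ω → Prop}
    (hE : ∀ n, MeasurableSet {ω | E n ω}) (huniq : ∀ ω m n, E m ω → E n ω → m = n)
    {f : ℕ → Ω → ℝ} (hf : ∀ n, Measurable (f n)) {g : Ω → ℝ} (hg : Measurable g) :
    Measurable fun ω => if h : ∃ n, E n ω then f h.choose ω else g ω := by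
  intro s hs
  set F : Ω → ℝ := fun ω => if h : ∃ n, E n ω then f h.choose ω else g ω with hF
  have hF1 : ∀ n ω, E n ω → F ω = f n ω := fun n ω hn => by
    have hex : ∃ n, E n ω := ⟨n, hn⟩
    simp only [hF]
    rw [dif_pos hex, huniq ω _ _ hex.choose_spec hn]
  have hF2 : ∀ ω, (¬ ∃ n, E n ω) → F ω = g ω := fun ω hn => dif_neg hn
  have heq : F ⁻¹' s
      = (⋃ n, {ω | E n ω} ∩ f n ⁻¹' s) ∪ ((⋃ n, {ω | E n ω})ᶜ ∩ g ⁻¹' s) := by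
    ext ω
    simp only [Set.mem_preimage, Set.mem_union, Set.mem_iUnion, Set.mem_inter_iff,
      Set.mem_ofPred_eq, Set.mem_compl_iff]
    by_cases h : ∃ n, E n ω
    · obtain ⟨n, hn⟩ := h
      rw [hF1 n ω hn]
      constructor
      · exact fun hs => Or.inl ⟨n, hn, hs⟩
      · rintro (⟨k, hk, hs⟩ | ⟨hne, -⟩)
        · rwa [huniq ω _ _ hn hk]
        · exact absurd ⟨n, hn⟩ hne
    · rw [hF2 ω h]
      constructor
      · exact fun hs => Or.inr ⟨h, hs⟩
      · rintro (⟨k, hk, -⟩ | ⟨-, hs⟩)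
        · exact absurd ⟨k, hk⟩ h
        · exact hs
  rw [heq]
  exact (MeasurableSet.iUnion fun n => (hE n).inter (hf n hs)).union
    ((MeasurableSet.iUnion hE).compl.inter (hg hs))

namespace BiddingProcess

variable {Ω : Type*} [MeasurableSpace Ω] {P : Measure Ω} {rate : ℝ} {ν ν₀ : Measure ℝ}

/-! ### The value of a rule before each offer -/

/-- The event that none of the first `n` offers is accepted before the deadline. -/
def unsold (B : BiddingProcess P rate ν ν₀) (t : ℝ) (τ : Ω → WithTop ℕ) (n : ℕ) : Set Ω :=
  {ω | ∀ k < n, ¬ B.SoldAt t τ k ω}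

theorem salePrice_of_soldAt {B : BiddingProcess P rate ν ν₀} {t : ℝ} {τ : Ω → WithTop ℕ} {n : ℕ}
    {ω : Ω} (h : B.SoldAt t τ n ω) : B.salePrice t τ ω = B.X n ω := by
  have hex : ∃ n, B.SoldAt t τ n ω := ⟨n, h⟩
  rw [salePrice, dif_pos hex, hex.choose_spec.unique h]

theorem saleTime_of_soldAt {B : BiddingProcess P rate ν ν₀} {t : ℝ} {τ : Ω → WithTop ℕ} {n : ℕ}
    {ω : Ω} (h : B.SoldAt t τ n ω) : B.saleTime t τ ω = t - B.timeLeft t (n + 1) ω := by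
  have hex : ∃ n, B.SoldAt t τ n ω := ⟨n, h⟩
  rw [saleTime, dif_pos hex, hex.choose_spec.unique h]

theorem measurableSet_past_soldAt (B : BiddingProcess P rate ν ν₀) (t : ℝ) {τ : Ω → WithTop ℕ}
    (hτ : IsStoppingTime B.history τ) {k n : ℕ} (hk : k < n) :
    MeasurableSet[B.past n] {ω | B.SoldAt t τ k ω} := by
  refine B.past_mono (Nat.succ_le_of_lt hk) _ ?_
  have h := hτ.measurableSet_eq k
  rw [history_eq_past] at h
  exact h.inter (B.measurable_past_timeLeft t (k + 1) measurableSet_Ioi)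

theorem measurableSet_soldAt (B : BiddingProcess P rate ν ν₀) (t : ℝ) {τ : Ω → WithTop ℕ}
    (hτ : IsStoppingTime B.history τ) (k : ℕ) : MeasurableSet {ω | B.SoldAt t τ k ω} :=
  B.past_le _ _ (B.measurableSet_past_soldAt t hτ k.lt_succ_self)

theorem measurableSet_past_unsold (B : BiddingProcess P rate ν ν₀) (t : ℝ) {τ : Ω → WithTop ℕ}
    (hτ : IsStoppingTime B.history τ) (n : ℕ) : MeasurableSet[B.past n] (B.unsold t τ n) := by
  have h : B.unsold t τ n = ⋂ k, ⋂ (_ : k < n), {ω | B.SoldAt t τ k ω}ᶜ := by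
    ext ω
    simp [unsold]
  rw [h]
  exact MeasurableSet.iInter fun k => MeasurableSet.iInter fun hk =>
    (B.measurableSet_past_soldAt t hτ hk).compl

theorem measurable_salePrice (B : BiddingProcess P rate ν ν₀) (t : ℝ) {τ : Ω → WithTop ℕ}
    (hτ : IsStoppingTime B.history τ) : Measurable (B.salePrice t τ) :=
  measurable_dite_choose (B.measurableSet_soldAt t hτ) (fun _ _ _ hm hn => hm.unique hn)
    B.measurable_X B.measurable_X₀

theorem measurable_saleTime (B : BiddingProcess P rate ν ν₀) (t : ℝ) {τ : Ω → WithTop ℕ}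
    (hτ : IsStoppingTime B.history τ) : Measurable (B.saleTime t τ) :=
  measurable_dite_choose (B.measurableSet_soldAt t hτ) (fun _ _ _ hm hn => hm.unique hn)
    (f := fun n ω => t - B.timeLeft t (n + 1) ω)
    (fun n => (B.measurable_timeLeft t (n + 1)).const_sub t) measurable_const

open Classical in
/-- The value after `n` offers under the rule `τ`: the sale price if the asset is sold, and
otherwise the value `m` at the time left. -/
noncomputable def stageValue (B : BiddingProcess P rate ν ν₀) (m : ℝ → ℝ) (t : ℝ)
    (τ : Ω → WithTop ℕ) (n : ℕ) (ω : Ω) : ℝ :=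
  if ω ∈ B.unsold t τ n then m (B.timeLeft t n ω) else B.salePrice t τ ω

open Classical in
/-- The sale price with the residual price replaced by its expectation. -/
noncomputable def limitValue (B : BiddingProcess P rate ν ν₀) (μ₀ : ℝ) (t : ℝ)
    (τ : Ω → WithTop ℕ) (ω : Ω) : ℝ :=
  if ∀ k, ¬ B.SoldAt t τ k ω then μ₀ else B.salePrice t τ ω

section Value

variable {B : BiddingProcess P rate ν ν₀} {μ₀ : ℝ} {m : ℝ → ℝ} {t : ℝ} {τ : Ω → WithTop ℕ}

theorem stageValue_zero (ω : Ω) : B.stageValue m t τ 0 ω = m t := by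
  simp [stageValue, unsold, timeLeft]

theorem mem_unsold_succ {n : ℕ} {ω : Ω} :
    ω ∈ B.unsold t τ (n + 1) ↔ ω ∈ B.unsold t τ n ∧ ¬ B.SoldAt t τ n ω := by
  simp only [unsold, Set.mem_ofPred_eq, Nat.lt_succ_iff_lt_or_eq]
  constructor
  · exact fun h => ⟨fun k hk => h k (Or.inl hk), h n (Or.inr rfl)⟩
  · rintro ⟨h1, h2⟩ k (hk | rfl)
    · exact h1 k hk
    · exact h2

theorem stageValue_succ_of_notMem {n : ℕ} {ω : Ω} (h : ω ∉ B.unsold t τ n) :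
    B.stageValue m t τ (n + 1) ω = B.stageValue m t τ n ω := by
  rw [stageValue, stageValue, if_neg h, if_neg fun h' => h (mem_unsold_succ.1 h').1]

theorem stageValue_succ_of_mem {n : ℕ} {ω : Ω} (h : ω ∈ B.unsold t τ n)
    [Decidable (B.SoldAt t τ n ω)] :
    B.stageValue m t τ (n + 1) ω =
      if B.SoldAt t τ n ω then B.X n ω else m (B.timeLeft t (n + 1) ω) := by
  by_cases hs : B.SoldAt t τ n ω
  · rw [if_pos hs, stageValue, if_neg fun h' => (mem_unsold_succ.1 h').2 hs, salePrice_of_soldAt hs]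
  · rw [if_neg hs, stageValue, if_pos (mem_unsold_succ.2 ⟨h, hs⟩)]

theorem nextValue_of_timeLeft_pos {n : ℕ} {ω : Ω} (h : 0 < B.timeLeft t (n + 1) ω) :
    nextValue m (B.timeLeft t n ω) (B.D n ω) (B.X n ω)
      = max (B.X n ω) (m (B.timeLeft t (n + 1) ω)) := by
  have h1 : 0 < B.timeLeft t n ω - B.D n ω := by
    by_contra h2
    exact h.ne' (max_eq_right (not_lt.1 h2))
  rw [nextValue, if_pos h1, timeLeft, max_eq_left h1.le]

theorem nextValue_of_timeLeft_eq_zero {n : ℕ} {ω : Ω} (h : B.timeLeft t (n + 1) ω = 0) :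
    nextValue m (B.timeLeft t n ω) (B.D n ω) (B.X n ω) = m 0 := by
  have h1 : ¬ 0 < B.timeLeft t n ω - B.D n ω := fun h2 =>
    (h2.trans_le (le_max_left _ 0)).ne' h
  rw [nextValue, if_neg h1]

theorem stageValue_succ_le_nextValue (ht : 0 ≤ t) {n : ℕ} {ω : Ω} (h : ω ∈ B.unsold t τ n) :
    B.stageValue m t τ (n + 1) ω ≤ nextValue m (B.timeLeft t n ω) (B.D n ω) (B.X n ω) := by
  classical
  rw [stageValue_succ_of_mem h]
  rcases (B.timeLeft_nonneg ht (n + 1) ω).eq_or_lt with h0 | h0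
  · rw [nextValue_of_timeLeft_eq_zero h0.symm, if_neg fun hs => hs.2.ne h0, ← h0]
  · rw [nextValue_of_timeLeft_pos h0]
    split_ifs
    · exact le_max_left _ _
    · exact le_max_right _ _

/-- Accepting exactly the offers that are at least the value `m` of continuing loses nothing. -/
theorem stageValue_succ_eq_nextValue (ht : 0 ≤ t) {n : ℕ} {ω : Ω} (h : ω ∈ B.unsold t τ n)
    (hτ : B.SoldAt t τ n ω ↔
      0 < B.timeLeft t (n + 1) ω ∧ m (B.timeLeft t (n + 1) ω) ≤ B.X n ω) :
    B.stageValue m t τ (n + 1) ω = nextValue m (B.timeLeft t n ω) (B.D n ω) (B.X n ω) := by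
  classical
  rw [stageValue_succ_of_mem h]
  rcases (B.timeLeft_nonneg ht (n + 1) ω).eq_or_lt with h0 | h0
  · rw [nextValue_of_timeLeft_eq_zero h0.symm, if_neg fun hs => hs.2.ne h0, ← h0]
  · rw [nextValue_of_timeLeft_pos h0]
    split_ifs with hs
    · rw [max_eq_left (hτ.1 hs).2]
    · rw [max_eq_right (not_le.1 fun hle => hs (hτ.2 ⟨h0, hle⟩)).le]

theorem stageValue_tendsto_limitValue (hm : m 0 = μ₀) {ω : Ω}
    (hω : ∀ᶠ n in atTop, B.timeLeft t n ω = 0) :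
    Tendsto (fun n => B.stageValue m t τ n ω) atTop (𝓝 (B.limitValue μ₀ t τ ω)) := by
  refine tendsto_const_nhds.congr' ?_
  by_cases h : ∀ k, ¬ B.SoldAt t τ k ω
  · filter_upwards [hω] with n hn
    have hmem : ω ∈ B.unsold t τ n := fun k _ => h k
    rw [limitValue, if_pos h, stageValue, if_pos hmem, hn, hm]
  · obtain ⟨k, hk⟩ := not_forall_not.1 h
    filter_upwards [eventually_gt_atTop k] with n hn
    rw [limitValue, if_neg h, stageValue, if_neg fun h' => h' k hn hk]

theorem integrable_apply_timeLeft [IsProbabilityMeasure P] (hrate : 0 < rate)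
    (hm : IsValueCurve rate ν μ₀ m) (hμ₀ : 0 ≤ μ₀) (ht : 0 ≤ t) (n : ℕ) :
    Integrable (fun ω => m (B.timeLeft t n ω)) P := by
  refine Integrable.of_bound
    (hm.continuous.measurable.comp (B.measurable_timeLeft t n)).aestronglyMeasurable (m t) ?_
  filter_upwards [B.ae_D_pos hrate] with ω hD
  rw [Real.norm_of_nonneg (hμ₀.trans (hm.le_apply (B.timeLeft_nonneg ht n ω)))]
  exact hm.monotone (B.timeLeft_antitone ht hD (Nat.zero_le n))

theorem integrable_nextValue [IsProbabilityMeasure P] (hrate : 0 < rate)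
    (hν : Integrable (fun x : ℝ => max x 0) ν)
    (hm : IsValueCurve rate ν μ₀ m) (hμ₀ : 0 ≤ μ₀) (ht : 0 ≤ t) (n : ℕ) :
    Integrable (fun ω => nextValue m (B.timeLeft t n ω) (B.D n ω) (B.X n ω)) P := by
  have hX : Integrable (fun ω => max (B.X n ω) 0) P := by
    rw [← B.law_X n] at hν
    exact hν.comp_measurable (B.measurable_X n)
  have hmeas : Measurable fun ω => (B.timeLeft t n ω, B.D n ω, B.X n ω) :=
    (B.measurable_timeLeft t n).prodMk ((B.measurable_D n).prodMk (B.measurable_X n))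
  refine (hX.add (integrable_apply_timeLeft (B := B) hrate hm hμ₀ ht n)).mono'
    (hm.measurable_nextValue.comp hmeas).aestronglyMeasurable ?_
  filter_upwards [B.ae_D_pos hrate] with ω hD
  exact hm.abs_nextValue_le hμ₀ (B.timeLeft_nonneg ht n ω) (hD n) _

/-- Before the next offer, the value after it has the same expectation as the current value. -/
theorem integral_piecewise_nextValue [IsProbabilityMeasure P] [IsProbabilityMeasure ν]
    (hrate : 0 < rate) (hν : Integrable (fun x : ℝ => max x 0) ν)
    (hm : IsValueCurve rate ν μ₀ m) (hμ₀ : 0 ≤ μ₀) (ht : 0 ≤ t)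
    (hτ : IsStoppingTime B.history τ) {n : ℕ} (hint : Integrable (B.stageValue m t τ n) P)
    [DecidablePred (· ∈ B.unsold t τ n)] :
    ∫ ω, (B.unsold t τ n).piecewise
        (fun ω => nextValue m (B.timeLeft t n ω) (B.D n ω) (B.X n ω)) (B.stageValue m t τ n) ω ∂P
      = ∫ ω, B.stageValue m t τ n ω ∂P := by
  have hA := B.measurableSet_past_unsold t hτ n
  have hA' := B.past_le n _ hA
  have hnext := integrable_nextValue (B := B) hrate hν hm hμ₀ ht n
  rw [integral_piecewise hA' hnext.integrableOn hint.integrableOn,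
    B.setIntegral_next_eq hrate ht hA hm.measurable_nextValue
      (fun s hs => hm.integral_nextValue hrate hν hμ₀ hs) hnext.integrableOn,
    ← integral_add_compl hA' hint]
  congr 1
  exact setIntegral_congr_fun hA' fun ω hω => (if_pos hω).symm

/-- The residual price is independent of the event that no offer is accepted, so that only its mean
matters. -/
theorem integral_salePrice_eq_integral_limitValue [IsProbabilityMeasure P]
    (hμ₀ : μ₀ = ∫ x, x ∂ν₀)
    (hτ : IsStoppingTime B.history τ) (hint : Integrable (B.salePrice t τ) P) :
    ∫ ω, B.salePrice t τ ω ∂P = ∫ ω, B.limitValue μ₀ t τ ω ∂P := by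
  classical
  set N : Set Ω := {ω | ∀ k, ¬ B.SoldAt t τ k ω} with hN
  have hNpast : MeasurableSet[⨆ n, B.past n] N := by
    have h : N = ⋂ k, {ω | B.SoldAt t τ k ω}ᶜ := by
      ext ω
      simp [hN]
    rw [h]
    exact MeasurableSet.iInter fun k =>
      (le_iSup B.past (k + 1) _ (B.measurableSet_past_soldAt t hτ k.lt_succ_self)).compl
  have hNm : MeasurableSet N := iSup_le B.past_le _ hNpast
  have hlim : B.limitValue μ₀ t τ = N.piecewise (fun _ => μ₀) (B.salePrice t τ) := by
    ext ω
    by_cases hω : ω ∈ N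
    · rw [Set.piecewise_eq_of_mem _ _ _ hω]
      exact if_pos hω
    · rw [Set.piecewise_eq_of_notMem _ _ _ hω]
      exact if_neg hω
  have hX₀ : ∫ ω, B.X₀ ω ∂P = μ₀ := by
    have h := integral_map (μ := P) B.measurable_X₀.aemeasurable
      (f := fun x : ℝ => x) (by fun_prop)
    rw [B.law_X₀] at h
    rw [hμ₀, h]
  rw [hlim, integral_piecewise hNm (integrable_const _).integrableOn hint.integrableOn,
    ← integral_add_compl hNm hint]
  congr 1
  calc ∫ ω in N, B.salePrice t τ ω ∂P = ∫ ω in N, B.X₀ ω ∂P :=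
        setIntegral_congr_fun hNm fun ω hω => dif_neg (not_exists.2 hω)
    _ = P.real N * ∫ ω, B.X₀ ω ∂P :=
        Indep.setIntegral_eq_mul (iSup_le B.past_le) (f := fun x : ℝ => x)
          B.indep_iSup_past_residual B.measurable_X₀.aemeasurable hNpast (by fun_prop)
    _ = ∫ ω in N, μ₀ ∂P := by
        rw [hX₀, setIntegral_const, smul_eq_mul]

end Value

/-! ### The threshold rule -/

open Classical in
/-- The rule that accepts the first offer that is at least `m` at the time left. -/
noncomputable def thresholdRule (B : BiddingProcess P rate ν ν₀) (m : ℝ → ℝ) (t : ℝ) (ω : Ω) :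
    WithTop ℕ :=
  if h : ∃ n, m (B.timeLeft t (n + 1) ω) ≤ B.X n ω then ((Nat.find h : ℕ) : WithTop ℕ) else ⊤

section Threshold

variable {B : BiddingProcess P rate ν ν₀} {μ₀ : ℝ} {m : ℝ → ℝ} {t : ℝ}

theorem thresholdRule_eq_coe_iff {n : ℕ} {ω : Ω} :
    B.thresholdRule m t ω = (n : WithTop ℕ) ↔ m (B.timeLeft t (n + 1) ω) ≤ B.X n ω ∧
      ∀ k < n, ¬ m (B.timeLeft t (k + 1) ω) ≤ B.X k ω := by
  classical
  by_cases h : ∃ n, m (B.timeLeft t (n + 1) ω) ≤ B.X n ω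
  · rw [thresholdRule, dif_pos h, ← Nat.find_eq_iff h]
    exact WithTop.coe_injective.eq_iff
  · rw [thresholdRule, dif_neg h]
    exact ⟨fun h' => absurd h' (WithTop.top_ne_coe), fun h' => absurd ⟨n, h'.1⟩ h⟩

theorem exists_thresholdRule_eq {n : ℕ} {ω : Ω} (h : m (B.timeLeft t (n + 1) ω) ≤ B.X n ω) :
    ∃ j ≤ n, B.thresholdRule m t ω = (j : WithTop ℕ) := by
  classical
  have hex : ∃ n, m (B.timeLeft t (n + 1) ω) ≤ B.X n ω := ⟨n, h⟩
  exact ⟨Nat.find hex, Nat.find_min' hex h, by rw [thresholdRule, dif_pos hex]⟩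

theorem isStoppingTime_thresholdRule (hm : Measurable m) :
    IsStoppingTime B.history (B.thresholdRule m t) := by
  refine isStoppingTime_of_measurableSet_eq fun n => ?_
  rw [history_eq_past]
  have hk : ∀ k ≤ n,
      MeasurableSet[B.past (n + 1)] {ω | m (B.timeLeft t (k + 1) ω) ≤ B.X k ω} := fun k hk =>
    B.past_mono (Nat.succ_le_succ hk) _ (measurableSet_le
      (hm.comp (B.measurable_past_timeLeft t (k + 1))) (B.measurable_past_X k.lt_succ_self))
  have heq : {ω | B.thresholdRule m t ω = (n : WithTop ℕ)}
      = {ω | m (B.timeLeft t (n + 1) ω) ≤ B.X n ω} ∩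
        ⋂ k, ⋂ (_ : k < n), {ω | m (B.timeLeft t (k + 1) ω) ≤ B.X k ω}ᶜ := by
    ext ω
    rw [Set.mem_ofPred_eq, thresholdRule_eq_coe_iff]
    simp
  have hmeas : MeasurableSet[B.past (n + 1)] {ω | B.thresholdRule m t ω = (n : WithTop ℕ)} := by
    rw [heq]
    exact (hk n le_rfl).inter (MeasurableSet.iInter fun k => MeasurableSet.iInter fun h =>
      (hk k h.le).compl)
  exact hmeas

/-- While the asset is unsold, the next offer is accepted exactly if it is large enough: the rule
cannot have picked an earlier offer that came too late, since the time left decreases. -/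
theorem soldAt_thresholdRule_iff (ht : 0 ≤ t) {ω : Ω} (hD : ∀ n, 0 < B.D n ω) {n : ℕ}
    (hω : ω ∈ B.unsold t (B.thresholdRule m t) n) :
    B.SoldAt t (B.thresholdRule m t) n ω ↔
      0 < B.timeLeft t (n + 1) ω ∧ m (B.timeLeft t (n + 1) ω) ≤ B.X n ω := by
  constructor
  · rintro ⟨h1, h2⟩
    exact ⟨h2, (thresholdRule_eq_coe_iff.1 h1).1⟩
  · rintro ⟨h1, h2⟩
    obtain ⟨j, hj, hjτ⟩ := exists_thresholdRule_eq h2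
    have hsold : B.SoldAt t (B.thresholdRule m t) j ω :=
      ⟨hjτ, h1.trans_le (B.timeLeft_antitone ht hD (Nat.succ_le_succ hj))⟩
    rcases hj.eq_or_lt with rfl | hlt
    · exact hsold
    · exact absurd hsold (hω j hlt)

theorem exists_soldAt_thresholdRule_iff (ht : 0 ≤ t) {ω : Ω} (hD : ∀ n, 0 < B.D n ω) {c : ℝ} :
    (∃ n, B.SoldAt t (B.thresholdRule m t) n ω ∧ c ≤ B.timeLeft t (n + 1) ω) ↔
      ∃ n, AcceptsBy m c (B.timeLeft t (n + 1) ω) (B.X n ω) := by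
  constructor
  · rintro ⟨n, ⟨h1, h2⟩, h3⟩
    exact ⟨n, h2, h3, (thresholdRule_eq_coe_iff.1 h1).1⟩
  · rintro ⟨n, h1, h2, h3⟩
    obtain ⟨j, hj, hjτ⟩ := exists_thresholdRule_eq h3
    have hle := B.timeLeft_antitone ht hD (Nat.succ_le_succ hj)
    exact ⟨j, ⟨hjτ, h1.trans_le hle⟩, h2.trans hle⟩

/-! ### Verification: the solution of the equation is the optimal value -/

theorem tendsto_integral_stageValue [IsProbabilityMeasure P] (hrate : 0 < rate)
    (hm : IsValueCurve rate ν μ₀ m) (hμ₀_nonneg : 0 ≤ μ₀) (ht : 0 ≤ t) {τ : Ω → WithTop ℕ}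
    (hint : Integrable (B.salePrice t τ) P)
    (hstage : ∀ n, Integrable (B.stageValue m t τ n) P) :
    Tendsto (fun n => ∫ ω, B.stageValue m t τ n ω ∂P) atTop
      (𝓝 (∫ ω, B.limitValue μ₀ t τ ω ∂P)) := by
  refine tendsto_integral_of_dominated_convergence (fun ω => |B.salePrice t τ ω| + m t)
    (fun n => (hstage n).aestronglyMeasurable) (hint.abs.add (integrable_const _))
    (fun n => ?_) ?_
  · filter_upwards [B.ae_D_pos hrate] with ω hD
    have h0 : 0 ≤ m t := hμ₀_nonneg.trans (hm.le_apply ht)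
    rw [stageValue]
    split_ifs
    · have h1 := hμ₀_nonneg.trans (hm.le_apply (B.timeLeft_nonneg ht n ω))
      have h2 : m (B.timeLeft t n ω) ≤ m t :=
        hm.monotone (B.timeLeft_antitone ht hD (Nat.zero_le n))
      rw [Real.norm_of_nonneg h1]
      linarith [abs_nonneg (B.salePrice t τ ω)]
    · rw [Real.norm_eq_abs]
      linarith
  · filter_upwards [B.ae_eventually_timeLeft_eq_zero hrate ht] with ω hω
    exact stageValue_tendsto_limitValue hm.zero hω

/-- Along any rule, the stage values form a supermartingale that starts at `m t` and ends at the
sale price. -/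
theorem integral_salePrice_le [IsProbabilityMeasure P] [IsProbabilityMeasure ν]
    (hrate : 0 < rate) (hν : Integrable (fun x : ℝ => max x 0) ν) (hμ₀ : μ₀ = ∫ x, x ∂ν₀)
    (hm : IsValueCurve rate ν μ₀ m) (hμ₀_nonneg : 0 ≤ μ₀) (ht : 0 ≤ t) {τ : Ω → WithTop ℕ}
    (hτ : IsStoppingTime B.history τ) (hint : Integrable (B.salePrice t τ) P) :
    ∫ ω, B.salePrice t τ ω ∂P ≤ m t := by
  classical
  have hA' : ∀ n, MeasurableSet (B.unsold t τ n) := fun n =>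
    B.past_le n _ (B.measurableSet_past_unsold t hτ n)
  have hstage : ∀ n, Integrable (B.stageValue m t τ n) P := fun n =>
    Integrable.piecewise (s := B.unsold t τ n) (hA' n)
      (integrable_apply_timeLeft hrate hm hμ₀_nonneg ht n).integrableOn hint.integrableOn
  have hanti : Antitone fun n => ∫ ω, B.stageValue m t τ n ω ∂P := by
    refine antitone_nat_of_succ_le fun n => ?_
    rw [← integral_piecewise_nextValue hrate hν hm hμ₀_nonneg ht hτ (hstage n)]
    refine integral_mono (hstage (n + 1)) (Integrable.piecewise (hA' n)
      (integrable_nextValue hrate hν hm hμ₀_nonneg ht n).integrableOn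
      (hstage n).integrableOn) fun ω => ?_
    by_cases hω : ω ∈ B.unsold t τ n
    · rw [Set.piecewise_eq_of_mem _ _ _ hω]
      exact stageValue_succ_le_nextValue ht hω
    · rw [Set.piecewise_eq_of_notMem _ _ _ hω, stageValue_succ_of_notMem hω]
  rw [integral_salePrice_eq_integral_limitValue hμ₀ hτ hint]
  refine le_of_tendsto' (tendsto_integral_stageValue hrate hm hμ₀_nonneg ht hint hstage)
    fun n => (hanti (Nat.zero_le n)).trans ?_
  simp [stageValue_zero]

/-- Along the threshold rule, the stage values form a nonnegative martingale. -/
theorem integrable_stageValue_thresholdRule [IsProbabilityMeasure P] [IsProbabilityMeasure ν]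
    (hrate : 0 < rate) (hν : Integrable (fun x : ℝ => max x 0) ν)
    (hm : IsValueCurve rate ν μ₀ m) (hμ₀_nonneg : 0 ≤ μ₀) (ht : 0 ≤ t) (n : ℕ) :
    Integrable (B.stageValue m t (B.thresholdRule m t) n) P ∧
      ∫ ω, B.stageValue m t (B.thresholdRule m t) n ω ∂P = m t := by
  classical
  have hτ : IsStoppingTime B.history (B.thresholdRule m t) :=
    isStoppingTime_thresholdRule hm.continuous.measurable
  induction n with
  | zero =>
    have h : B.stageValue m t (B.thresholdRule m t) 0 = fun _ => m t := funext stageValue_zero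
    rw [h]
    exact ⟨integrable_const _, by simp⟩
  | succ n ih =>
    have hA' := B.past_le n _ (B.measurableSet_past_unsold t hτ n)
    have hae : (B.unsold t (B.thresholdRule m t) n).piecewise
        (fun ω => nextValue m (B.timeLeft t n ω) (B.D n ω) (B.X n ω))
        (B.stageValue m t (B.thresholdRule m t) n)
        =ᵐ[P] B.stageValue m t (B.thresholdRule m t) (n + 1) := by
      filter_upwards [B.ae_D_pos hrate] with ω hD
      by_cases hω : ω ∈ B.unsold t (B.thresholdRule m t) n
      · rw [Set.piecewise_eq_of_mem _ _ _ hω,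
          stageValue_succ_eq_nextValue ht hω (soldAt_thresholdRule_iff ht hD hω)]
      · rw [Set.piecewise_eq_of_notMem _ _ _ hω, stageValue_succ_of_notMem hω]
    refine ⟨(Integrable.piecewise hA'
      (integrable_nextValue hrate hν hm hμ₀_nonneg ht n).integrableOn
      ih.1.integrableOn).congr hae, ?_⟩
    rw [← integral_congr_ae hae, integral_piecewise_nextValue hrate hν hm hμ₀_nonneg ht hτ ih.1,
      ih.2]

theorem stageValue_thresholdRule_nonneg (hm : IsValueCurve rate ν μ₀ m) (hμ₀_nonneg : 0 ≤ μ₀)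
    (ht : 0 ≤ t) (n : ℕ) (ω : Ω) : 0 ≤ B.stageValue m t (B.thresholdRule m t) n ω := by
  have h : ∀ k, 0 ≤ m (B.timeLeft t k ω) := fun k =>
    hμ₀_nonneg.trans (hm.le_apply (B.timeLeft_nonneg ht k ω))
  by_cases hω : ω ∈ B.unsold t (B.thresholdRule m t) n
  · rw [stageValue, if_pos hω]
    exact h n
  · rw [stageValue, if_neg hω]
    simp only [unsold, Set.mem_ofPred_eq, not_forall, not_not] at hω
    obtain ⟨k, -, hk⟩ := hω
    rw [salePrice_of_soldAt hk]
    exact (h (k + 1)).trans (thresholdRule_eq_coe_iff.1 hk.1).1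

/-- Fatou's lemma applied to the nonnegative stage values. -/
theorem integrable_salePrice_thresholdRule [IsProbabilityMeasure P] [IsProbabilityMeasure ν]
    (hrate : 0 < rate) (hν : Integrable (fun x : ℝ => max x 0) ν)
    (hν₀ : Integrable (fun x : ℝ => x) ν₀)
    (hm : IsValueCurve rate ν μ₀ m) (hμ₀_nonneg : 0 ≤ μ₀) (ht : 0 ≤ t) :
    Integrable (B.salePrice t (B.thresholdRule m t)) P := by
  set τ := B.thresholdRule m t with hτdef
  have hτ : IsStoppingTime B.history τ := isStoppingTime_thresholdRule hm.continuous.measurable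
  have hstage := integrable_stageValue_thresholdRule (B := B) hrate hν hm hμ₀_nonneg ht
  have htend : ∀ᵐ ω ∂P, Tendsto (fun n => B.stageValue m t τ n ω) atTop
      (𝓝 (B.limitValue μ₀ t τ ω)) := by
    filter_upwards [B.ae_eventually_timeLeft_eq_zero hrate ht] with ω hω
    exact stageValue_tendsto_limitValue hm.zero hω
  have hlimm : AEStronglyMeasurable (B.limitValue μ₀ t τ) P :=
    aestronglyMeasurable_of_tendsto_ae atTop (fun n => (hstage n).1.aestronglyMeasurable) htend
  have hlim : Integrable (B.limitValue μ₀ t τ) P := by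
    refine ⟨hlimm, ?_⟩
    have hF := Lp.eLpNorm_lim_le_liminf_eLpNorm (p := 1) (f := B.stageValue m t τ)
      (fun n => (hstage n).1.aestronglyMeasurable) _ htend
    have h1 : ∀ n, eLpNorm (B.stageValue m t τ n) 1 P = ENNReal.ofReal (m t) := fun n => by
      rw [eLpNorm_one_eq_lintegral_enorm, ← (hstage n).2, ofReal_integral_eq_lintegral_ofReal
        (hstage n).1 (ae_of_all _ (stageValue_thresholdRule_nonneg hm hμ₀_nonneg ht n))]
      refine lintegral_congr fun ω => ?_
      rw [Real.enorm_of_nonneg (stageValue_thresholdRule_nonneg hm hμ₀_nonneg ht n ω)]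
    simp only [h1, liminf_const] at hF
    rw [hasFiniteIntegral_iff_enorm, ← eLpNorm_one_eq_lintegral_enorm]
    exact hF.trans_lt ENNReal.ofReal_lt_top
  have hX₀ : Integrable B.X₀ P := by
    rw [← B.law_X₀] at hν₀
    exact hν₀.comp_measurable B.measurable_X₀
  refine (hlim.abs.add hX₀.abs).mono' (B.measurable_salePrice t hτ).aestronglyMeasurable
    (ae_of_all _ fun ω => ?_)
  rw [Real.norm_eq_abs, Pi.add_apply]
  by_cases h : ∀ k, ¬ B.SoldAt t τ k ω
  · have h1 : B.salePrice t τ ω = B.X₀ ω := dif_neg (not_exists.2 h)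
    rw [h1]
    linarith [abs_nonneg (B.limitValue μ₀ t τ ω)]
  · rw [limitValue, if_neg h]
    linarith [abs_nonneg (B.X₀ ω)]

theorem integral_salePrice_thresholdRule [IsProbabilityMeasure P] [IsProbabilityMeasure ν]
    (hrate : 0 < rate) (hν : Integrable (fun x : ℝ => max x 0) ν)
    (hν₀ : Integrable (fun x : ℝ => x) ν₀) (hμ₀ : μ₀ = ∫ x, x ∂ν₀)
    (hm : IsValueCurve rate ν μ₀ m) (hμ₀_nonneg : 0 ≤ μ₀) (ht : 0 ≤ t) :
    ∫ ω, B.salePrice t (B.thresholdRule m t) ω ∂P = m t := by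
  set τ := B.thresholdRule m t with hτdef
  have hτ : IsStoppingTime B.history τ := isStoppingTime_thresholdRule hm.continuous.measurable
  have hstage := integrable_stageValue_thresholdRule (B := B) hrate hν hm hμ₀_nonneg ht
  have hint : Integrable (B.salePrice t τ) P :=
    integrable_salePrice_thresholdRule hrate hν hν₀ hm hμ₀_nonneg ht
  have hlim : Tendsto (fun n => ∫ ω, B.stageValue m t τ n ω ∂P) atTop
      (𝓝 (∫ ω, B.limitValue μ₀ t τ ω ∂P)) :=
    tendsto_integral_stageValue hrate hm hμ₀_nonneg ht hint fun n => (hstage n).1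
  rw [integral_salePrice_eq_integral_limitValue hμ₀ hτ hint]
  exact tendsto_nhds_unique hlim (tendsto_const_nhds.congr fun n => (hstage n).2.symm)

theorem optimalValue_eq [IsProbabilityMeasure P] [IsProbabilityMeasure ν]
    (hrate : 0 < rate) (hν : Integrable (fun x : ℝ => max x 0) ν)
    (hν₀ : Integrable (fun x : ℝ => x) ν₀) (hμ₀ : μ₀ = ∫ x, x ∂ν₀)
    (hm : IsValueCurve rate ν μ₀ m) (hμ₀_nonneg : 0 ≤ μ₀) (ht : 0 ≤ t) :
    B.optimalValue t = m t := by
  refine IsGreatest.csSup_eq ⟨⟨B.thresholdRule m t,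
    isStoppingTime_thresholdRule hm.continuous.measurable,
    integrable_salePrice_thresholdRule hrate hν hν₀ hm hμ₀_nonneg ht,
    (integral_salePrice_thresholdRule hrate hν hν₀ hμ₀ hm hμ₀_nonneg ht).symm⟩, ?_⟩
  rintro v ⟨τ, hτ, hint, rfl⟩
  exact integral_salePrice_le hrate hν hμ₀ hm hμ₀_nonneg ht hτ hint

theorem optimalRule_eq [IsProbabilityMeasure P] [IsProbabilityMeasure ν]
    (hrate : 0 < rate) (hν : Integrable (fun x : ℝ => max x 0) ν)
    (hν₀ : Integrable (fun x : ℝ => x) ν₀) (hμ₀ : μ₀ = ∫ x, x ∂ν₀)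
    (hm : IsValueCurve rate ν μ₀ m) (hμ₀_nonneg : 0 ≤ μ₀) (ht : 0 ≤ t) :
    B.optimalRule t = B.thresholdRule m t := by
  classical
  ext1 ω
  have h : ∀ n, B.optimalValue (B.timeLeft t (n + 1) ω) = m (B.timeLeft t (n + 1) ω) := fun n =>
    optimalValue_eq hrate hν hν₀ hμ₀ hm hμ₀_nonneg (B.timeLeft_nonneg ht (n + 1) ω)
  have key : ∀ p q : ℕ → Prop, p = q →
      (if h : ∃ n, p n then ((Nat.find h : ℕ) : WithTop ℕ) else ⊤)
        = if h : ∃ n, q n then ((Nat.find h : ℕ) : WithTop ℕ) else ⊤ := by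
    rintro p _ rfl
    rfl
  exact key _ _ (funext fun n => by rw [h])

/-! ### The law of the time to sale -/

/-- The probability that no offer is accepted while the time left is at least `c`: along the
threshold rule, `φ(m(·))` at the time left, stopped at `c` and killed at the sale, is a
martingale. -/
theorem measureReal_forall_not_acceptsBy [IsProbabilityMeasure P] [IsProbabilityMeasure ν]
    (hrate : 0 < rate) (hν : Integrable (fun x : ℝ => max x 0) ν)
    (hm : IsValueCurve rate ν μ₀ m) (ht : 0 ≤ t) {c : ℝ} (hc : 0 ≤ c) :
    P.real {ω | ∀ n, ¬ AcceptsBy m c (B.timeLeft t (n + 1) ω) (B.X n ω)}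
      = offerPhi ν (m (max t c)) / offerPhi ν (m c) := by
  have hmm := hm.continuous.measurable
  have hφm := (lipschitzWith_offerPhi hν).continuous.measurable
  set U : ℕ → Set Ω := fun n =>
    {ω | ∀ k < n, ¬ AcceptsBy m c (B.timeLeft t (k + 1) ω) (B.X k ω)} with hU
  set V : Set Ω := {ω | ∀ n, ¬ AcceptsBy m c (B.timeLeft t (n + 1) ω) (B.X n ω)} with hV
  have hacc : ∀ k n, k < n →
      MeasurableSet[B.past n] {ω | AcceptsBy m c (B.timeLeft t (k + 1) ω) (B.X k ω)} :=
    fun k n hk => B.past_mono (Nat.succ_le_of_lt hk) _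
      (((B.measurable_past_timeLeft t (k + 1)).prodMk (B.measurable_past_X k.lt_succ_self))
        (measurableSet_acceptsBy hmm c))
  have hUpast : ∀ n, MeasurableSet[B.past n] (U n) := fun n => by
    have h : U n = ⋂ k, ⋂ (_ : k < n),
        {ω | AcceptsBy m c (B.timeLeft t (k + 1) ω) (B.X k ω)}ᶜ := by
      ext ω
      simp [hU]
    rw [h]
    exact MeasurableSet.iInter fun k => MeasurableSet.iInter fun hk => (hacc k n hk).compl
  have hUm : ∀ n, MeasurableSet (U n) := fun n => B.past_le n _ (hUpast n)
  have hVm : MeasurableSet V := by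
    have h : V = ⋂ n, U n := by
      ext ω
      simp only [hV, hU, Set.mem_ofPred_eq, Set.mem_iInter]
      exact ⟨fun h n k _ => h k, fun h k => h (k + 1) k k.lt_succ_self⟩
    rw [h]
    exact MeasurableSet.iInter hUm
  set Y : ℕ → Ω → ℝ := fun n =>
    (U n).indicator fun ω => offerPhi ν (m (max (B.timeLeft t n ω) c)) with hY
  have hYm : ∀ n, Measurable (Y n) := fun n =>
    (hφm.comp (hmm.comp ((B.measurable_timeLeft t n).max measurable_const))).indicator (hUm n)
  have hstep : ∀ n, ∫ ω, Y (n + 1) ω ∂P = ∫ ω, Y n ω ∂P := fun n => by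
    have h : Y (n + 1) = (U n).indicator fun ω =>
        nextSurvival ν m c (B.timeLeft t n ω) (B.D n ω) (B.X n ω) := by
      ext ω
      have hmem : ω ∈ U (n + 1) ↔
          ω ∈ U n ∧ ¬ AcceptsBy m c (B.timeLeft t (n + 1) ω) (B.X n ω) := by
        simp only [hU, Set.mem_ofPred_eq, Nat.lt_succ_iff_lt_or_eq]
        constructor
        · exact fun h => ⟨fun k hk => h k (Or.inl hk), h n (Or.inr rfl)⟩
        · rintro ⟨h1, h2⟩ k (hk | rfl)
          · exact h1 k hk
          · exact h2
      by_cases h1 : ω ∈ U n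
      · by_cases h2 : AcceptsBy m c (B.timeLeft t (n + 1) ω) (B.X n ω)
        · simp only [hY, Set.indicator_of_mem h1, nextSurvival]
          rw [Set.indicator_of_notMem fun h' => (hmem.1 h').2 h2]
          exact (if_pos h2).symm
        · simp only [hY, Set.indicator_of_mem h1, nextSurvival]
          rw [Set.indicator_of_mem (hmem.2 ⟨h1, h2⟩)]
          exact (if_neg h2).symm
      · simp only [hY]
        rw [Set.indicator_of_notMem h1, Set.indicator_of_notMem fun h' => h1 (hmem.1 h').1]
    have hmeas : Measurable fun ω => (B.timeLeft t n ω, B.D n ω, B.X n ω) :=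
      (B.measurable_timeLeft t n).prodMk ((B.measurable_D n).prodMk (B.measurable_X n))
    have hint : Integrable (fun ω =>
        nextSurvival ν m c (B.timeLeft t n ω) (B.D n ω) (B.X n ω)) P :=
      Integrable.of_bound ((hm.measurable_nextSurvival hν c).comp hmeas).aestronglyMeasurable _
        (ae_of_all _ fun ω => hm.abs_nextSurvival_le hν c _ _ _)
    rw [h, integral_indicator (hUm n), B.setIntegral_next_eq hrate ht (hUpast n)
      (hm.measurable_nextSurvival hν c)
      (fun s _ => hm.integral_nextSurvival hrate hν hc s) hint.integrableOn]
    simp only [hY]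
    rw [integral_indicator (hUm n)]
  have hYint : ∀ n, ∫ ω, Y n ω ∂P = offerPhi ν (m (max t c)) := fun n => by
    induction n with
    | zero => simp [hY, hU, timeLeft]
    | succ n ih => rw [hstep, ih]
  have hlim : Tendsto (fun n => ∫ ω, Y n ω ∂P) atTop
      (𝓝 (∫ ω, V.indicator (fun _ => offerPhi ν (m c)) ω ∂P)) := by
    refine tendsto_integral_of_dominated_convergence (fun _ => offerPhi ν μ₀)
      (fun n => (hYm n).aestronglyMeasurable) (integrable_const _)
      (fun n => ae_of_all _ fun ω => ?_) ?_
    · simp only [hY, Set.indicator]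
      split_ifs
      · rw [Real.norm_of_nonneg (offerPhi_nonneg hν _)]
        exact offerPhi_antitone hν (hm.le_apply (hc.trans (le_max_right _ _)))
      · simpa using offerPhi_nonneg hν μ₀
    · filter_upwards [B.ae_eventually_timeLeft_eq_zero hrate ht] with ω hω
      refine tendsto_const_nhds.congr' ?_
      by_cases hωV : ω ∈ V
      · filter_upwards [hω] with n hn
        have hmem : ω ∈ U n := fun k _ => hωV k
        simp only [hY]
        rw [Set.indicator_of_mem hωV, Set.indicator_of_mem hmem, hn, max_eq_right hc]
      · obtain ⟨k, hk⟩ := not_forall_not.1 hωV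
        filter_upwards [eventually_gt_atTop k] with n hn
        have hmem : ω ∉ U n := fun h => h k hn hk
        simp only [hY]
        rw [Set.indicator_of_notMem hωV, Set.indicator_of_notMem hmem]
  have hfinal := tendsto_nhds_unique hlim (tendsto_const_nhds.congr fun n => (hYint n).symm)
  rw [integral_indicator hVm, setIntegral_const, smul_eq_mul] at hfinal
  rw [eq_div_iff (hm.offerPhi_pos c hc).ne', hfinal]

end Threshold

theorem saleTime_le (B : BiddingProcess P rate ν ν₀) {t : ℝ} (ht : 0 ≤ t) (τ : Ω → WithTop ℕ)
    (ω : Ω) : B.saleTime t τ ω ≤ t := by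
  by_cases h : ∃ n, B.SoldAt t τ n ω
  · obtain ⟨n, hn⟩ := h
    rw [saleTime_of_soldAt hn]
    linarith [B.timeLeft_nonneg ht (n + 1) ω]
  · exact (dif_neg h).le

theorem saleTime_eq_iff (B : BiddingProcess P rate ν ν₀) {t : ℝ} (τ : Ω → WithTop ℕ) (ω : Ω) :
    B.saleTime t τ ω = t ↔ ∀ n, ¬ B.SoldAt t τ n ω := by
  constructor
  · intro h n hn
    rw [saleTime_of_soldAt hn] at h
    linarith [hn.2]
  · exact fun h => dif_neg (not_exists.2 h)

theorem saleTime_le_iff (B : BiddingProcess P rate ν ν₀) {t r : ℝ} (hr : r < t)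
    (τ : Ω → WithTop ℕ) (ω : Ω) :
    B.saleTime t τ ω ≤ r ↔ ∃ n, B.SoldAt t τ n ω ∧ t - r ≤ B.timeLeft t (n + 1) ω := by
  constructor
  · intro h
    by_cases hs : ∀ n, ¬ B.SoldAt t τ n ω
    · rw [(B.saleTime_eq_iff τ ω).2 hs] at h
      linarith
    · obtain ⟨n, hn⟩ := not_forall_not.1 hs
      rw [saleTime_of_soldAt hn] at h
      exact ⟨n, hn, by linarith⟩
  · rintro ⟨n, hn, hle⟩
    rw [saleTime_of_soldAt hn]
    linarith

theorem ae_saleTime_nonneg (hrate : 0 < rate) (B : BiddingProcess P rate ν ν₀) {t : ℝ}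
    (ht : 0 ≤ t) (τ : Ω → WithTop ℕ) : ∀ᵐ ω ∂P, 0 ≤ B.saleTime t τ ω := by
  filter_upwards [B.ae_D_pos hrate] with ω hD
  by_cases h : ∀ n, ¬ B.SoldAt t τ n ω
  · rwa [(B.saleTime_eq_iff τ ω).2 h]
  · obtain ⟨n, hn⟩ := not_forall_not.1 h
    rw [saleTime_of_soldAt hn]
    have : B.timeLeft t (n + 1) ω ≤ t := B.timeLeft_antitone ht hD (Nat.zero_le (n + 1))
    linarith

/-- The distribution function of the time to sale under the threshold rule. -/
theorem measureReal_saleTime_le [IsProbabilityMeasure P] [IsProbabilityMeasure ν]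
    (hrate : 0 < rate) (hν : Integrable (fun x : ℝ => max x 0) ν) {μ₀ : ℝ} {m : ℝ → ℝ}
    (hm : IsValueCurve rate ν μ₀ m) (B : BiddingProcess P rate ν ν₀) {t : ℝ} (ht : 0 ≤ t) (r : ℝ) :
    P.real {ω | B.saleTime t (B.thresholdRule m t) ω ≤ r} =
      if r < 0 then 0
      else if r < t then 1 - offerPhi ν (m t) / offerPhi ν (m (t - r))
      else 1 := by
  set τ := B.thresholdRule m t with hτdef
  have hτ : IsStoppingTime B.history τ := isStoppingTime_thresholdRule hm.continuous.measurable
  split_ifs with h1 h2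
  · rw [measureReal_eq_zero_iff]
    refine measure_mono_null (fun ω hω => ?_) (ae_iff.1 (B.ae_saleTime_nonneg hrate ht τ))
    exact not_le.2 (lt_of_le_of_lt hω h1)
  · have h0 : 0 ≤ r := not_lt.1 h1
    have hcompl := measureReal_forall_not_acceptsBy (B := B) hrate hν hm ht (c := t - r)
      (by linarith)
    rw [max_eq_left (by linarith)] at hcompl
    have hmeas : MeasurableSet {ω | B.saleTime t τ ω ≤ r} :=
      B.measurable_saleTime t hτ measurableSet_Iic
    have hset : P.real {ω | B.saleTime t τ ω ≤ r}ᶜ = P.real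
        {ω | ∀ n, ¬ AcceptsBy m (t - r) (B.timeLeft t (n + 1) ω) (B.X n ω)} := by
      refine measureReal_congr ?_
      filter_upwards [B.ae_D_pos hrate] with ω hD
      refine propext ?_
      change ¬ (B.saleTime t τ ω ≤ r) ↔
        ∀ n, ¬ AcceptsBy m (t - r) (B.timeLeft t (n + 1) ω) (B.X n ω)
      rw [B.saleTime_le_iff h2, exists_soldAt_thresholdRule_iff ht hD, not_exists]
    rw [probReal_compl_eq_one_sub hmeas, hcompl] at hset
    linarith
  · have huniv : {ω | B.saleTime t τ ω ≤ r} = Set.univ :=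
      Set.eq_univ_of_forall fun ω => (B.saleTime_le ht τ ω).trans (not_lt.1 h2)
    rw [huniv, probReal_univ]

theorem measureReal_forall_not_soldAt [IsProbabilityMeasure P] [IsProbabilityMeasure ν]
    (hrate : 0 < rate) (hν : Integrable (fun x : ℝ => max x 0) ν) {μ₀ : ℝ} {m : ℝ → ℝ}
    (hm : IsValueCurve rate ν μ₀ m) (B : BiddingProcess P rate ν ν₀) {t : ℝ} (ht : 0 ≤ t) :
    P.real {ω | ∀ n, ¬ B.SoldAt t (B.thresholdRule m t) n ω} =
      offerPhi ν (m t) / offerPhi ν μ₀ := by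
  have h := measureReal_forall_not_acceptsBy (B := B) hrate hν hm ht (c := 0) le_rfl
  rw [max_eq_left ht, hm.zero] at h
  rw [← h]
  refine measureReal_congr ?_
  filter_upwards [B.ae_D_pos hrate] with ω hD
  refine propext ?_
  change (∀ n, ¬ B.SoldAt t (B.thresholdRule m t) n ω) ↔
    ∀ n, ¬ AcceptsBy m 0 (B.timeLeft t (n + 1) ω) (B.X n ω)
  have hiff := exists_soldAt_thresholdRule_iff (B := B) (m := m) ht hD (c := 0)
  simp only [B.timeLeft_nonneg ht, and_true] at hiff
  rw [← not_exists, ← not_exists, hiff]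

end BiddingProcess

theorem mainTheorem6 {Ω : Type*} [MeasurableSpace Ω] (P : Measure Ω) [IsProbabilityMeasure P]
    (rate : ℝ) (hrate : 0 < rate)
    (ν ν₀ : Measure ℝ) [IsProbabilityMeasure ν] [IsProbabilityMeasure ν₀]
    (hν : Integrable (fun x : ℝ => max x 0) ν)
    (hν₀ : Integrable (fun x : ℝ => x) ν₀)
    (μ₀ : ℝ) (hμ₀ : μ₀ = ∫ x, x ∂ν₀)
    (hμ₀_nonneg : 0 ≤ μ₀) (hμ₀_lt : (μ₀ : EReal) < offerSup ν)
    (B : BiddingProcess P rate ν ν₀) (t : ℝ) (ht : 0 ≤ t) :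
    Measurable (B.timeToSale t) ∧
    (∀ r : ℝ, P.real {ω | B.timeToSale t ω ≤ r} =
      if r < 0 then 0
      else if r < t then
        1 - offerPhi ν (B.optimalValue t) / offerPhi ν (B.optimalValue (t - r))
      else 1) ∧
    (∃ Hplus Hminus : ℝ,
      Tendsto (fun r => P.real {ω | B.timeToSale t ω ≤ r}) (𝓝[>] t) (𝓝 Hplus) ∧
      Tendsto (fun r => P.real {ω | B.timeToSale t ω ≤ r}) (𝓝[<] t) (𝓝 Hminus) ∧
      P.real {ω | B.timeToSale t ω = t} = Hplus - Hminus) ∧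
    P.real {ω | B.timeToSale t ω = t} =
      offerPhi ν (B.optimalValue t) / offerPhi ν μ₀ ∧
    P.real {ω | ∀ n, ¬ B.SoldAt t (B.optimalRule t) n ω} =
      offerPhi ν (B.optimalValue t) / offerPhi ν μ₀ := by
  obtain ⟨m, hm⟩ := exists_isValueCurve hrate hν hμ₀_lt
  have hval : ∀ s, 0 ≤ s → B.optimalValue s = m s := fun s hs =>
    BiddingProcess.optimalValue_eq hrate hν hν₀ hμ₀ hm hμ₀_nonneg hs
  have hτ : IsStoppingTime B.history (B.thresholdRule m t) :=
    BiddingProcess.isStoppingTime_thresholdRule hm.continuous.measurable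
  have hcdf := B.measureReal_saleTime_le hrate hν hm ht
  have hnever := B.measureReal_forall_not_soldAt hrate hν hm ht
  have heq : P.real {ω | B.saleTime t (B.thresholdRule m t) ω = t} =
      offerPhi ν (m t) / offerPhi ν μ₀ := by
    simp only [B.saleTime_eq_iff, hnever]
  have hpos : 0 < offerPhi ν μ₀ := hm.zero ▸ hm.offerPhi_pos 0 le_rfl
  unfold BiddingProcess.timeToSale
  rw [BiddingProcess.optimalRule_eq hrate hν hν₀ hμ₀ hm hμ₀_nonneg ht, hval t ht]
  refine ⟨B.measurable_saleTime t hτ, fun r => ?_,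
    ⟨1, 1 - offerPhi ν (m t) / offerPhi ν μ₀, ?_, ?_, ?_⟩, heq, hnever⟩
  · rw [hcdf r]
    split_ifs with h1 h2
    · rfl
    · rw [hval (t - r) (by linarith)]
    · rfl
  · refine tendsto_const_nhds.congr' ?_
    filter_upwards [self_mem_nhdsWithin] with r hr
    have hr' : t < r := hr
    rw [hcdf r, if_neg (by linarith), if_neg (by linarith)]
  · rcases ht.eq_or_lt with rfl | ht'
    · -- At `t = 0` the limit from the left is taken along negative times.
      rw [hm.zero, div_self hpos.ne', sub_self]
      refine tendsto_const_nhds.congr' ?_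
      filter_upwards [self_mem_nhdsWithin] with r hr
      have hr' : r < 0 := hr
      rw [hcdf r, if_pos hr']
    · have hcont : ContinuousAt (fun r => 1 - offerPhi ν (m t) / offerPhi ν (m (t - r))) t := by
        refine continuousAt_const.sub (continuousAt_const.div ?_ ?_)
        · exact ((lipschitzWith_offerPhi hν).continuous.comp
            (hm.continuous.comp (continuous_const.sub continuous_id))).continuousAt
        · rw [sub_self, hm.zero]
          exact hpos.ne'
      have hlim := hcont.tendsto.mono_left (nhdsWithin_le_nhds (s := Set.Iio t))
      rw [sub_self, hm.zero] at hlim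
      refine hlim.congr' ?_
      filter_upwards [Ioo_mem_nhdsLT ht'] with r hr
      rw [hcdf r, if_neg (not_lt.2 hr.1.le), if_pos hr.2]
  · rw [heq]
    ring
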